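/- Let $\Omega\subset\mathbb{R}^2$ be a bounded Lipschitz domain, $T>0$, $\lambda>0$, and let $s>1$ be real. Put $$\mathcal H=C^1([0,T],H^{s-1}(\Omega))\cap C^0([0,T],H^{s}(\Omega)),\qquad H_{sym}=\{X\in\mathcal H^{2\times2}: X^T=X\}.$$ Let $P$ be a real-analytic function on $(0,\infty)$, applied to symmetric positive definite matrices by functional calculus (for example $P(\sigma)=\sigma-1$ or $P(\sigma)=\sigma-1+\alpha(\sigma-1)^2$). Let $u\in C^0([0,T],H^s(\Omega,\mathbb{R}^2))$ be given and write $(\nabla u)_{ij}=\partial_j u_i$, $\varepsilon(u)=\frac12(\nabla u+\nabla u^T)$, $\Omega(u)=\frac12(\nabla u-\nabla u^T)$, $[X,Y]=XY-YX$ and $\gamma(C)=\frac12(C_{11}-C_{22})$. If $\Psi\in H_{sym}$ (with no bound on its norm) solves $$\partial_t\Psi+(u\cdot\nabla)\Psi+[\Psi,\Omega(u)]+\frac1\lambda P(e^{\Psi})e^{-\Psi}-2\varepsilon(u)-2\begin{pmatrix}-\Psi_{12}&\gamma(\Psi)\\ \gamma(\Psi)&\Psi_{12}\end{pmatrix}\bigl[\gamma(\Psi)\,\varepsilon(u)_{12}-\Psi_{12}\,\gamma(\varepsilon(u))\bigr]f(\Psi)=0$$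 on $[0,T]\times\Omega$ (as an identity in $H^{s-1}(\Omega)^{2\times 2}$ for every $t\in[0,T]$), where $$f(\Psi)=\frac{1}{r^2}\Bigl(r+\frac{2r}{e^{2r}-1}-1\Bigr),\qquad r=\sqrt{\gamma(\Psi)^2+\Psi_{12}^2},$$ with the limit value $f=\frac13$ where $r=0$, then $\sigma=\exp\Psi$ belongs to $H_{sym}$ and solves, in the same sense, $$\partial_t\sigma+(u\cdot\nabla)\sigma-(\varepsilon(u)+\Omega(u))\sigma-\sigma(\varepsilon(u)-\Omega(u))=-\frac1\lambda P(\sigma).$$ -/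

import Mathlib

open MeasureTheory Set Filter Topology
open scoped ENNReal NNReal ContDiff SchwartzMap Matrix

noncomputable section

namespace LogConf

/-- The Euclidean plane `ℝ²`. -/
abbrev Plane : Type := EuclideanSpace ℝ (Fin 2)

/-- Real `2 × 2` matrices. -/
abbrev Mat : Type := Matrix (Fin 2) (Fin 2) ℝ

/-! ### The domain -/

/-- A bounded Lipschitz domain in the plane: a bounded, connected, non-empty open set that near
every boundary point is, in suitably rotated Cartesian coordinates, the region strictly above the
graph of a Lipschitz function. -/
structure IsBoundedLipschitzDomain (Ω : Set Plane) : Prop where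
  isOpen : IsOpen Ω
  isConnected : IsConnected Ω
  isBounded : Bornology.IsBounded Ω
  boundary : ∀ p ∈ frontier Ω, ∃ (e : Plane ≃ₗᵢ[ℝ] Plane) (φ : ℝ → ℝ) (K : ℝ≥0), LipschitzWith K φ ∧
    ∀ᶠ x in 𝓝 p, (x ∈ Ω ↔ φ (e x 0) < e x 1)

/-! ### Sobolev spaces

A scalar field on `Ω` is represented by a function on the plane of which only the values at almost
every point of `Ω` matter. The space `H^s(Ω)`, `s ≥ 0`, consists of the restrictions to `Ω` of the
elements of `H^s(ℝ²)`, with the quotient norm. Extensions may be complex-valued: taking the real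
part of an extension of a real field does not increase its norm. -/

/-- `v ∈ H^s(Ω)`, for `s ≥ 0`. -/
def MemHs (s : ℝ) (Ω : Set Plane) (v : Plane → ℝ) : Prop :=
  ∃ g : Lp ℂ 2 (volume : Measure Plane),
    TemperedDistribution.MemSobolev s 2 (g : 𝓢'(Plane, ℂ)) ∧
      ∀ᵐ x ∂(volume.restrict Ω), g x = (v x : ℂ)

/-- The norm of `H^s(Ω)`, for `s ≥ 0`: the infimum of `‖(1 + |ξ|²)^{s/2} ĝ‖_{L²}` over all
`g ∈ H^s(ℝ²)` that agree with `v` almost everywhere in `Ω` (and `∞` if there is no such `g`). -/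
def hsNorm (s : ℝ) (Ω : Set Plane) (v : Plane → ℝ) : ℝ≥0∞ :=
  ⨅ (g : Lp ℂ 2 (volume : Measure Plane)) (h : Lp ℂ 2 (volume : Measure Plane))
    (_ : TemperedDistribution.besselPotential Plane ℂ s (g : 𝓢'(Plane, ℂ)) = (h : 𝓢'(Plane, ℂ)))
    (_ : ∀ᵐ x ∂(volume.restrict Ω), g x = (v x : ℂ)), ‖h‖ₑ

/-- `v ∈ C⁰([0,T], H^s(Ω))`. -/
def MemC0Hs (s T : ℝ) (Ω : Set Plane) (v : ℝ → Plane → ℝ) : Prop :=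
  (∀ t ∈ Icc 0 T, MemHs s Ω (v t)) ∧
    ∀ t₀ ∈ Icc 0 T, Tendsto (fun t => hsNorm s Ω (v t - v t₀)) (𝓝[Icc 0 T] t₀) (𝓝 0)

/-- `v'` is the derivative of `v : [0,T] → H^s(Ω)` and is continuous: `∂ₜ v = v'`, where
the difference quotients converge in `H^s(Ω)` (one-sided at `0` and at `T`),
and `v' ∈ C⁰([0,T], H^s(Ω))`. -/
def HasTimeDeriv (s T : ℝ) (Ω : Set Plane) (v v' : ℝ → Plane → ℝ) : Prop :=
  MemC0Hs s T Ω v' ∧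
    ∀ t₀ ∈ Icc 0 T,
      Tendsto (fun t => hsNorm s Ω ((t - t₀)⁻¹ • (v t - v t₀) - v' t₀))
        (𝓝[Icc 0 T \ {t₀}] t₀) (𝓝 0)

/-- `∂ᵢ v = w` in `Ω` in the weak sense. -/
def HasWeakPartial (Ω : Set Plane) (i : Fin 2) (v w : Plane → ℝ) : Prop :=
  LocallyIntegrableOn v Ω ∧ LocallyIntegrableOn w Ω ∧
    ∀ φ : Plane → ℝ, ContDiff ℝ ∞ φ → HasCompactSupport φ → tsupport φ ⊆ Ω →
      ∫ x in Ω, v x * fderiv ℝ φ x (EuclideanSpace.single i 1) = - ∫ x in Ω, w x * φ x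

/-- The space `𝓗 = C¹([0,T], H^{s-1}(Ω)) ∩ C⁰([0,T], H^s(Ω))`. -/
def MemH (s T : ℝ) (Ω : Set Plane) (v : ℝ → Plane → ℝ) : Prop :=
  MemC0Hs s T Ω v ∧ ∃ v', HasTimeDeriv (s - 1) T Ω v v'

/-- The space `H_sym` of symmetric matrix fields with entries in `𝓗`. -/
def MemHsym (s T : ℝ) (Ω : Set Plane) (Ψ : ℝ → Plane → Mat) : Prop :=
  (∀ i j, MemH s T Ω (fun t x => Ψ t x i j)) ∧
    ∀ t ∈ Icc 0 T, ∀ᵐ x ∂(volume.restrict Ω), (Ψ t x)ᵀ = Ψ t x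

/-! ### Derivatives of the fields -/

/-- `Ψ'` is the time derivative of the matrix field `Ψ`, entrywise in `C⁰([0,T], H^{s-1}(Ω))`. -/
def IsTimeDerivative (s T : ℝ) (Ω : Set Plane) (Ψ Ψ' : ℝ → Plane → Mat) : Prop :=
  ∀ i j, HasTimeDeriv (s - 1) T Ω (fun t x => Ψ t x i j) (fun t x => Ψ' t x i j)

/-- `DΨ k = ∂ₖ Ψ` for the matrix field `Ψ`, entrywise at every time in `[0,T]`. -/
def IsSpaceDerivative (T : ℝ) (Ω : Set Plane) (Ψ : ℝ → Plane → Mat)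
    (DΨ : Fin 2 → ℝ → Plane → Mat) : Prop :=
  ∀ t ∈ Icc 0 T, ∀ k i j, HasWeakPartial Ω k (fun x => Ψ t x i j) (fun x => DΨ k t x i j)

/-- `L = ∇u`, with entries `L i j = ∂ⱼ uᵢ`, at every time in `[0,T]`. -/
def IsVelocityGradient (T : ℝ) (Ω : Set Plane) (u : ℝ → Plane → Plane) (L : ℝ → Plane → Mat) :
    Prop :=
  ∀ t ∈ Icc 0 T, ∀ i j, HasWeakPartial Ω j (fun x => u t x i) (fun x => L t x i j)

/-- The strain `ε = (∇u + ∇uᵀ) / 2` as a function of `L = ∇u`. -/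
def strain (L : Mat) : Mat := (1 / 2 : ℝ) • (L + Lᵀ)

/-- The vorticity tensor `(∇u - ∇uᵀ) / 2` as a function of `L = ∇u`. -/
def vorticity (L : Mat) : Mat := (1 / 2 : ℝ) • (L - Lᵀ)

/-! ### The two equations

`P(σ)` is the functional calculus of the symmetric matrix `σ` (it applies `P` to the eigenvalues and
keeps the eigenvectors). Each equation is an identity in `H^{s-1}(Ω)` at every time `t ∈ [0,T]`,
hence almost everywhere in `Ω`. -/

/-- `σ` solves the constitutive equation
`∂ₜσ + (u·∇)σ - (ε(u) + Ω(u)) σ - σ (ε(u) - Ω(u)) = -(1/λ) P(σ)`. -/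
def SolvesConstitutive (s T : ℝ) (Ω : Set Plane) (lam : ℝ) (P : ℝ → ℝ) (u : ℝ → Plane → Plane)
    (σ : ℝ → Plane → Mat) : Prop :=
  ∃ (σ' : ℝ → Plane → Mat) (Dσ : Fin 2 → ℝ → Plane → Mat) (L : ℝ → Plane → Mat),
    IsTimeDerivative s T Ω σ σ' ∧ IsSpaceDerivative T Ω σ Dσ ∧ IsVelocityGradient T Ω u L ∧
    ∀ t ∈ Icc 0 T, ∀ᵐ x ∂(volume.restrict Ω),
      σ' t x + ∑ k, u t x k • Dσ k t x
          - (strain (L t x) + vorticity (L t x)) * σ t x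
          - σ t x * (strain (L t x) - vorticity (L t x))
        = -(1 / lam) • cfc P (σ t x)

/-- `γ(C) = (C₁₁ - C₂₂) / 2`. -/
def gam (C : Mat) : ℝ := (C 0 0 - C 1 1) / 2

/-- The function `r ↦ (r + 2r / (e^{2r} - 1) - 1) / r²`, with its limit `1/3` at `r = 0`. -/
def fScalar (r : ℝ) : ℝ :=
  if r = 0 then 1 / 3 else (r + 2 * r / (Real.exp (2 * r) - 1) - 1) / r ^ 2

/-- `f(Ψ)`, the above function at `r = √(γ(Ψ)² + Ψ₁₂²)`. -/
def f (Ψ : Mat) : ℝ := fScalar (Real.sqrt (gam Ψ ^ 2 + Ψ 0 1 ^ 2))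

/-- The matrix with rows `(-Ψ₁₂, γ(Ψ))` and `(γ(Ψ), Ψ₁₂)`. -/
def rotMat (Ψ : Mat) : Mat := !![-Ψ 0 1, gam Ψ; gam Ψ, Ψ 0 1]

/-- `Ψ` solves the two-dimensional log-conformation equation
`∂ₜΨ + (u·∇)Ψ + [Ψ, Ω(u)] + (1/λ) P(e^Ψ) e^{-Ψ} - 2 ε(u)
  - 2 ((-Ψ₁₂, γ(Ψ)), (γ(Ψ), Ψ₁₂)) [γ(Ψ) ε(u)₁₂ - Ψ₁₂ γ(ε(u))] f(Ψ) = 0`. -/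
def SolvesLogConf (s T : ℝ) (Ω : Set Plane) (lam : ℝ) (P : ℝ → ℝ) (u : ℝ → Plane → Plane)
    (Ψ : ℝ → Plane → Mat) : Prop :=
  ∃ (Ψ' : ℝ → Plane → Mat) (DΨ : Fin 2 → ℝ → Plane → Mat) (L : ℝ → Plane → Mat),
    IsTimeDerivative s T Ω Ψ Ψ' ∧ IsSpaceDerivative T Ω Ψ DΨ ∧ IsVelocityGradient T Ω u L ∧
    ∀ t ∈ Icc 0 T, ∀ᵐ x ∂(volume.restrict Ω),
      Ψ' t x + ∑ k, u t x k • DΨ k t x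
          + (Ψ t x * vorticity (L t x) - vorticity (L t x) * Ψ t x)
          + (1 / lam) • (cfc P (NormedSpace.exp (Ψ t x)) * NormedSpace.exp (-Ψ t x))
          - (2 : ℝ) • strain (L t x)
          - (2 * (gam (Ψ t x) * strain (L t x) 0 1 - Ψ t x 0 1 * gam (strain (L t x)))
              * f (Ψ t x)) • rotMat (Ψ t x)
        = 0

end LogConf

end

/-!
The theorem is a chain rule. Writing `dexp Ψ X` for the derivative of the matrix exponential at `Ψ`
in the direction `X`, the field `σ = exp Ψ` satisfies `∂ₜσ = dexp Ψ (∂ₜΨ)` and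
`∂ₖσ = dexp Ψ (∂ₖΨ)`. Since `dexp Ψ` is linear, it suffices to apply it to the log-conformation
equation: it maps `[Ψ, W]` to `[σ, W]` (`dexp_commutator`) and matrices that commute with `Ψ` to
their products with `σ` (`dexp_of_commute`), so `P(σ) σ⁻¹` to `P(σ)`. The terms with the strain `ε`
go to `εσ + σε` by an explicit computation for symmetric `2 × 2` matrices (`dexp_strain`): the
function `f` is chosen exactly so that the divided difference of `exp` between the two eigenvalues
of `Ψ` becomes the mean of its two values.

The analytic part is to make sense of the chain rule. In the plane, for `s > 1` and `0 ≤ r ≤ s`,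
multiplication is bounded `H^s × H^r → H^r`. On Schwartz functions this is a Cauchy–Schwarz estimate
of the convolution on the Fourier side, whose kernel is controlled by the integrable function
`(1 + |ξ|²)^{-s}` (`enorm_bessel_schwartzMul_le`); it passes to `H^r(Ω)` by density of Schwartz
functions (`exists_hsNorm_mul_le`). The norm of `H^r(Ω)` is countably subadditive
(`hsNorm_le_tsum`), so the power series of `exp` and `dexp` can be estimated term by term, without
any bound on the size of `Ψ`. For `r = s` and `r = s - 1` this gives continuity and
differentiability in time (`MatC0.exp`, `isTimeDerivative_exp`), from
`exp A - exp B = dexp A B (A - B)` with the polarized `dexp A B`, and from Lipschitz bounds for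
`dexp A B` in `A` and `B`. For the derivatives in space, the product rule holds for limits of
Schwartz functions, and weak derivatives pass to limits in `L²(Ω)`; the case `r = 0` of the product
estimate makes the series of derivatives converge there (`MatPartial.exp`).

Of the domain only openness and boundedness matter, the latter because constants have to belong to
`H^s(Ω)`.
-/

namespace LogConf

/-! ### Schwartz functions: Bessel potentials and products -/

section SchwartzEstimates

open FourierTransform

/-- The Fourier symbol `(1 + |ξ|²)^{r/2}` of the Bessel potential. -/
noncomputable def weight (r : ℝ) (ξ : Plane) : ℝ := (1 + ‖ξ‖ ^ 2) ^ (r / 2)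

lemma weight_pos (r : ℝ) (ξ : Plane) : 0 < weight r ξ := by unfold weight; positivity

lemma weight_neg (r : ℝ) (ξ : Plane) : weight r (-ξ) = weight r ξ := by simp [weight]

lemma weight_temperate (r : ℝ) : (fun ξ : Plane => ((weight r ξ : ℝ) : ℂ)).HasTemperateGrowth := by
  unfold weight; fun_prop

lemma weight_mono {r s : ℝ} (h : r ≤ s) (ξ : Plane) : weight r ξ ≤ weight s ξ := by
  unfold weight
  apply Real.rpow_le_rpow_of_exponent_le
  · nlinarith [sq_nonneg ‖ξ‖]
  · linarith

lemma enorm_weight (r : ℝ) (ξ : Plane) :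
    ‖((weight r ξ : ℝ) : ℂ)‖ₑ = ENNReal.ofReal (weight r ξ) := by
  rw [← ofReal_norm, Complex.norm_real, Real.norm_of_nonneg (weight_pos r ξ).le]

lemma weight_mul (r s : ℝ) (ξ : Plane) : weight r ξ * weight s ξ = weight (r + s) ξ := by
  unfold weight
  rw [← Real.rpow_add (by positivity)]
  congr 1; ring

/-- The Bessel potential of order `r` on Schwartz functions. -/
noncomputable def bessel (r : ℝ) : 𝓢(Plane, ℂ) →L[ℂ] 𝓢(Plane, ℂ) :=
  SchwartzMap.fourierMultiplierCLM ℂ (fun ξ => ((weight r ξ : ℝ) : ℂ))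

/-- Plancherel's identity for a Fourier multiplier applied to a Schwartz function. -/
lemma enorm_sq_fourierMultiplier {m : Plane → ℂ} (hm : m.HasTemperateGrowth) (f : 𝓢(Plane, ℂ)) :
    ‖(SchwartzMap.fourierMultiplierCLM ℂ m f).toLp 2‖ₑ ^ 2 =
      ∫⁻ ξ, (‖m ξ‖ₑ * ‖𝓕 f ξ‖ₑ) ^ 2 := by
  have h1 : ‖(SchwartzMap.fourierMultiplierCLM ℂ m f).toLp 2‖ₑ =
      ‖(SchwartzMap.smulLeftCLM ℂ m (𝓕 f)).toLp 2‖ₑ := by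
    have := SchwartzMap.norm_fourier_toL2_eq (SchwartzMap.fourierMultiplierCLM ℂ m f)
    rw [← enorm_eq_iff_norm_eq] at this
    rw [← this, SchwartzMap.fourierMultiplierCLM_apply, FourierTransform.fourier_fourierInv_eq]
  rw [h1, Lp.enorm_def, eLpNorm_congr_ae (SchwartzMap.coeFn_toLp _ 2 volume),
    eLpNorm_eq_lintegral_rpow_enorm_toReal (by norm_num) (by norm_num)]
  simp only [ENNReal.toReal_ofNat, one_div]
  rw [← ENNReal.rpow_natCast, ← ENNReal.rpow_mul]
  norm_num
  congr 1 with ξ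
  rw [SchwartzMap.smulLeftCLM_apply_apply hm]
  simp

/-- Pointwise domination of symbols gives domination of the `L²` norms. -/
lemma enorm_fourierMultiplier_le {m₁ m₂ : Plane → ℂ} (h₁ : m₁.HasTemperateGrowth)
    (h₂ : m₂.HasTemperateGrowth) (K : ℝ≥0) (hK : ∀ ξ, ‖m₁ ξ‖ₑ ≤ K * ‖m₂ ξ‖ₑ) (f : 𝓢(Plane, ℂ)) :
    ‖(SchwartzMap.fourierMultiplierCLM ℂ m₁ f).toLp 2‖ₑ ≤
      K * ‖(SchwartzMap.fourierMultiplierCLM ℂ m₂ f).toLp 2‖ₑ := by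
  rw [← ENNReal.pow_le_pow_left_iff (n := 2) (by norm_num), mul_pow,
    enorm_sq_fourierMultiplier h₁, enorm_sq_fourierMultiplier h₂,
    ← lintegral_const_mul' _ _ (by finiteness)]
  refine lintegral_mono fun ξ => ?_
  rw [← mul_pow, ← mul_assoc]
  gcongr
  exact hK ξ

lemma bessel_zero (f : 𝓢(Plane, ℂ)) : bessel 0 f = f := by
  have : (fun ξ : Plane => ((weight 0 ξ : ℝ) : ℂ)) = fun _ => 1 := by
    ext; simp [weight]
  simp [bessel, this]

lemma bessel_bessel (r s : ℝ) (f : 𝓢(Plane, ℂ)) : bessel r (bessel s f) = bessel (r + s) f := by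
  unfold bessel
  rw [SchwartzMap.fourierMultiplierCLM_fourierMultiplierCLM_apply (weight_temperate _)
    (weight_temperate _)]
  congr 2
  ext ξ
  simp [← weight_mul]

lemma enorm_bessel_mono {r s : ℝ} (h : r ≤ s) (f : 𝓢(Plane, ℂ)) :
    ‖(bessel r f).toLp 2‖ₑ ≤ ‖(bessel s f).toLp 2‖ₑ := by
  have := enorm_fourierMultiplier_le (weight_temperate r) (weight_temperate s) 1 (fun ξ => by
    rw [ENNReal.coe_one, one_mul, enorm_weight, enorm_weight]
    exact ENNReal.ofReal_le_ofReal (weight_mono h ξ)) f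
  simpa [bessel] using this

/-- The unit vector in the direction of the `k`-th coordinate. -/
noncomputable abbrev unitVec (k : Fin 2) : Plane := EuclideanSpace.single k 1

open LineDeriv in
lemma enorm_lineDeriv_le {s : ℝ} (h : 1 ≤ s) (k : Fin 2) (f : 𝓢(Plane, ℂ)) :
    ‖(∂_{unitVec k} f : 𝓢(Plane, ℂ)).toLp 2‖ₑ ≤
      (2 * Real.pi).toNNReal * ‖(bessel s f).toLp 2‖ₑ := by
  have h0 : (fun ξ : Plane => ((inner ℝ ξ (unitVec k) : ℝ) : ℂ)).HasTemperateGrowth := by fun_prop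
  have h0' : (fun ξ : Plane => (2 * Real.pi * Complex.I) *
      ((inner ℝ ξ (unitVec k) : ℝ) : ℂ)).HasTemperateGrowth := by fun_prop
  have e : (∂_{unitVec k} f : 𝓢(Plane, ℂ)) = SchwartzMap.fourierMultiplierCLM ℂ
      ((2 * Real.pi * Complex.I) • fun ξ : Plane => ((inner ℝ ξ (unitVec k) : ℝ) : ℂ)) f := by
    rw [SchwartzMap.fourierMultiplierCLM_smul h0, SchwartzMap.lineDeriv_eq_fourierMultiplierCLM]
    rw [_root_.smul_apply]
    congr 1
    rw [← SchwartzMap.fourierMultiplierCLM_ofReal ℂ (by fun_prop)]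
    rfl
  rw [e]
  refine enorm_fourierMultiplier_le (by exact h0') (weight_temperate s) _ (fun ξ => ?_) f
  have h1 : |inner ℝ ξ (unitVec k)| ≤ weight s ξ := by
    refine (abs_real_inner_le_norm _ _).trans ?_
    simp only [PiLp.norm_single, norm_one, mul_one]
    refine le_trans ?_ (weight_mono h ξ)
    unfold weight
    rw [← Real.sqrt_eq_rpow]
    apply Real.le_sqrt_of_sq_le; linarith
  rw [← ofReal_norm, ← ofReal_norm]
  change _ ≤ ENNReal.ofReal (2 * Real.pi) * _
  rw [← ENNReal.ofReal_mul (by positivity)]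
  apply ENNReal.ofReal_le_ofReal
  simp only [Pi.smul_apply, smul_eq_mul, norm_mul, Complex.norm_real, Complex.norm_I,
    Real.norm_eq_abs, mul_one, Complex.norm_ofNat, abs_of_pos Real.pi_pos,
    abs_of_pos (weight_pos s ξ)]
  gcongr

/-- The pointwise product of Schwartz functions. -/
noncomputable def schwartzMul (f g : 𝓢(Plane, ℂ)) : 𝓢(Plane, ℂ) :=
  SchwartzMap.pairing (ContinuousLinearMap.mul ℂ ℂ) f g

lemma schwartzMul_apply (f g : 𝓢(Plane, ℂ)) (x : Plane) : schwartzMul f g x = f x * g x := rfl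

/-- A form of Peetre's inequality, in which the larger frequency dominates. -/
lemma weight_add_le {r : ℝ} (hr : 0 ≤ r) (x y : Plane) (h : ‖x‖ ≤ ‖y‖) :
    weight r (x + y) ≤ 2 ^ r * weight r y := by
  have h1 : 1 + ‖x + y‖ ^ 2 ≤ 4 * (1 + ‖y‖ ^ 2) := by
    have h2 : ‖x + y‖ ≤ 2 * ‖y‖ := (norm_add_le x y).trans (by linarith)
    nlinarith [norm_nonneg (x + y)]
  have h4 : (2 : ℝ) ^ r = 4 ^ (r / 2) := by
    rw [show (4 : ℝ) = 2 ^ (2 : ℝ) by norm_num, ← Real.rpow_mul (by norm_num)]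
    congr 1; ring
  unfold weight
  rw [h4, ← Real.mul_rpow (by norm_num) (by positivity)]
  exact Real.rpow_le_rpow (by positivity) h1 (by linarith)

lemma weight_le_of_norm_le {a : ℝ} (ha : a ≤ 0) {x y : Plane} (h : ‖y‖ ≤ ‖x‖) :
    weight a x ≤ weight a y := by
  unfold weight
  exact Real.rpow_le_rpow_of_nonpos (by positivity) (by gcongr) (by linarith)

/-- The kernel of the product estimate compares the weight at the output frequency `x + y` with
the weights at the input frequencies `x` and `y`. For each `x + y` its square is integrable, with a
bound that does not depend on `x + y`. -/
lemma weight_kernel_le {r s : ℝ} (hr : 0 ≤ r) (hrs : r ≤ s) (x y : Plane) :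
    (weight r (x + y) * (weight (-s) x * weight (-r) y)) ^ 2 ≤
      (2 ^ r) ^ 2 * (weight (-2 * s) x + weight (-2 * s) y) := by
  have key : ∀ a b : Plane, ∀ t, weight r a ≤ 2 ^ r * weight r b →
      weight r b * (weight (-s) x * weight (-r) y) ≤ t → 0 ≤ t →
      (weight r a * (weight (-s) x * weight (-r) y)) ^ 2 ≤ (2 ^ r) ^ 2 * t ^ 2 := by
    intro a b t h1 h2 ht
    rw [← mul_pow]
    have p1 := weight_pos (-s) x
    have p2 := weight_pos (-r) y
    have p3 := weight_pos r a
    refine pow_le_pow_left₀ (by positivity) ?_ 2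
    calc _ ≤ (2 ^ r * weight r b) * (weight (-s) x * weight (-r) y) := by gcongr
      _ = 2 ^ r * (weight r b * (weight (-s) x * weight (-r) y)) := by ring
      _ ≤ _ := by gcongr
  have sq : ∀ z : Plane, weight (-s) z ^ 2 = weight (-2 * s) z := by
    intro z; rw [sq, weight_mul]; congr 1; ring
  have pos : ∀ a, ∀ z : Plane, 0 ≤ weight a z := fun a z => (weight_pos a z).le
  rcases le_total ‖x‖ ‖y‖ with h | h
  -- the factor with the larger frequency absorbs the weight of order `r`
  · refine (key (x + y) y (weight (-s) x) (weight_add_le hr x y h) ?_ (pos _ _)).trans ?_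
    · rw [mul_left_comm, weight_mul]; simp [weight]
    · rw [sq]
      have := pos (-2 * s) y
      gcongr; linarith
  · refine (key (x + y) x (weight (-s) y) ?_ ?_ (pos _ _)).trans ?_
    · rw [add_comm]; exact weight_add_le hr y x h
    -- here the surplus weight `⟨x⟩ ^ (r - s)` at the larger frequency is traded for one at `y`
    · rw [← mul_assoc, weight_mul]
      calc _ ≤ weight (r + -s) y * weight (-r) y := by
            gcongr
            · exact pos _ _
            · exact weight_le_of_norm_le (by linarith) h
        _ = _ := by rw [weight_mul]; congr 1; ring
    · rw [sq]
      have := pos (-2 * s) x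
      gcongr; linarith

lemma lintegral_weight_lt_top {s : ℝ} (hs : 1 < s) :
    ∫⁻ ξ, ENNReal.ofReal (weight (-2 * s) ξ) < ⊤ := by
  have h := integrable_rpow_neg_one_add_norm_sq (E := Plane) (μ := volume) (r := 2 * s)
    (by simp; linarith)
  have h2 := h.lintegral_lt_top
  convert h2 using 5
  unfold weight
  congr 1; ring

lemma sq_lintegral_mul_le {α : Type*} [MeasurableSpace α] (μ : Measure α) {f g : α → ℝ≥0∞}
    (hf : AEMeasurable f μ) (hg : AEMeasurable g μ) :
    (∫⁻ a, f a * g a ∂μ) ^ 2 ≤ (∫⁻ a, f a ^ 2 ∂μ) * ∫⁻ a, g a ^ 2 ∂μ := by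
  have := ENNReal.lintegral_mul_le_Lp_mul_Lq μ Real.HolderConjugate.two_two hf hg
  have h2 := pow_le_pow_left' this 2
  rw [mul_pow, ← ENNReal.rpow_natCast, ← ENNReal.rpow_natCast, ← ENNReal.rpow_natCast,
    ← ENNReal.rpow_mul, ← ENNReal.rpow_mul] at h2
  norm_num at h2
  simpa using h2

/-- The inverse Fourier transform of a product of Schwartz functions is a convolution. -/
lemma fourierInv_schwartzMul (f g : 𝓢(Plane, ℂ)) (ξ : Plane) :
    𝓕⁻ (schwartzMul f g) ξ = ∫ t, 𝓕⁻ f t * 𝓕⁻ g (ξ - t) := by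
  have h := SchwartzMap.convolution_apply (ContinuousLinearMap.mul ℂ ℂ) (𝓕⁻ f) (𝓕⁻ g) ξ
  rw [convolution_def] at h
  simp only [ContinuousLinearMap.mul_apply'] at h
  rw [← h]
  have h2 := SchwartzMap.fourier_convolution (ContinuousLinearMap.mul ℂ ℂ) (𝓕⁻ f) (𝓕⁻ g)
  rw [FourierTransform.fourier_fourierInv_eq, FourierTransform.fourier_fourierInv_eq] at h2
  change 𝓕⁻ (SchwartzMap.pairing (ContinuousLinearMap.mul ℂ ℂ) f g) ξ = _
  rw [← h2, FourierTransform.fourierInv_fourier_eq]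

lemma fourier_apply_eq_fourierInv (f : 𝓢(Plane, ℂ)) (ξ : Plane) : 𝓕 f ξ = 𝓕⁻ f (-ξ) := by
  rw [SchwartzMap.fourierInv_apply_eq]
  simp

lemma enorm_sq_bessel (r : ℝ) (f : 𝓢(Plane, ℂ)) :
    ‖(bessel r f).toLp 2‖ₑ ^ 2 = ∫⁻ ξ, (ENNReal.ofReal (weight r ξ) * ‖𝓕⁻ f ξ‖ₑ) ^ 2 := by
  rw [bessel, enorm_sq_fourierMultiplier (weight_temperate r),
    ← lintegral_neg_eq_self]
  simp only [enorm_weight, weight_neg, fourier_apply_eq_fourierInv, neg_neg]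

lemma measurable_weight (r : ℝ) : Measurable (weight r) := by
  unfold weight; fun_prop

/-- The bound is uniform in the output frequency `ξ`. -/
lemma lintegral_kernel_le {r s : ℝ} (hr : 0 ≤ r) (hrs : r ≤ s) (ξ : Plane) :
    ∫⁻ t, ENNReal.ofReal (weight r ξ * (weight (-s) t * weight (-r) (ξ - t))) ^ 2 ≤
      ENNReal.ofReal ((2 ^ r) ^ 2) * ((∫⁻ t, ENNReal.ofReal (weight (-2 * s) t)) +
        ∫⁻ t, ENNReal.ofReal (weight (-2 * s) t)) := by
  calc _ ≤ ∫⁻ t, ENNReal.ofReal ((2 ^ r) ^ 2) * (ENNReal.ofReal (weight (-2 * s) t) +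
            ENNReal.ofReal (weight (-2 * s) (ξ - t))) := by
          refine lintegral_mono fun t => ?_
          have := weight_pos
          rw [← ENNReal.ofReal_pow (mul_pos (this _ _) (mul_pos (this _ _) (this _ _))).le,
            ← ENNReal.ofReal_add (weight_pos _ _).le (weight_pos _ _).le,
            ← ENNReal.ofReal_mul (by positivity)]
          apply ENNReal.ofReal_le_ofReal
          have := weight_kernel_le hr hrs t (ξ - t)
          rwa [add_sub_cancel] at this
      _ = _ := by
          rw [lintegral_const_mul' _ _ (by finiteness),
            lintegral_add_left (measurable_weight _).ennreal_ofReal,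
            lintegral_sub_left_eq_self (fun t => ENNReal.ofReal (weight (-2 * s) t)) ξ]

lemma enorm_fourierInv_schwartzMul_le (r s : ℝ) (f g : 𝓢(Plane, ℂ)) (ξ : Plane) :
    ENNReal.ofReal (weight r ξ) * ‖𝓕⁻ (schwartzMul f g) ξ‖ₑ ≤
      ∫⁻ t, ENNReal.ofReal (weight r ξ * (weight (-s) t * weight (-r) (ξ - t))) *
        ((ENNReal.ofReal (weight s t) * ‖𝓕⁻ f t‖ₑ) *
          (ENNReal.ofReal (weight r (ξ - t)) * ‖𝓕⁻ g (ξ - t)‖ₑ)) := by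
  rw [fourierInv_schwartzMul]
  refine (mul_le_mul_right (enorm_integral_le_lintegral_enorm _) _).trans ?_
  rw [← lintegral_const_mul' _ _ (by finiteness)]
  refine lintegral_mono fun t => le_of_eq ?_
  simp only [enorm_mul]
  have e1 : weight (-s) t * weight s t = 1 := by rw [weight_mul]; simp [weight]
  have e2 : weight (-r) (ξ - t) * weight r (ξ - t) = 1 := by rw [weight_mul]; simp [weight]
  have p := fun a (z : Plane) => (weight_pos a z).le
  calc _ = ENNReal.ofReal (weight r ξ * (weight (-s) t * weight s t) *
        (weight (-r) (ξ - t) * weight r (ξ - t))) * (‖𝓕⁻ f t‖ₑ * ‖𝓕⁻ g (ξ - t)‖ₑ) := by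
        rw [e1, e2, mul_one, mul_one]
    _ = ENNReal.ofReal (weight r ξ * (weight (-s) t * weight (-r) (ξ - t)) *
        weight s t * weight r (ξ - t)) * (‖𝓕⁻ f t‖ₑ * ‖𝓕⁻ g (ξ - t)‖ₑ) := by
        congr 2; ring
    _ = _ := by
        rw [ENNReal.ofReal_mul' (p _ _), ENNReal.ofReal_mul' (p _ _)]
        ring

lemma lintegral_sq_convolution {F G : Plane → ℝ≥0∞} (mF : Measurable F) (mG : Measurable G) :
    ∫⁻ ξ, ∫⁻ t, (F t * G (ξ - t)) ^ 2 = (∫⁻ t, F t ^ 2) * ∫⁻ t, G t ^ 2 := by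
  rw [lintegral_lintegral_swap (by fun_prop)]
  simp only [mul_pow]
  have : ∀ t, ∫⁻ ξ, F t ^ 2 * G (ξ - t) ^ 2 = F t ^ 2 * ∫⁻ ξ, G ξ ^ 2 := by
    intro t
    rw [lintegral_const_mul _ (by fun_prop), lintegral_sub_right_eq_self (fun ξ => G ξ ^ 2)]
  simp only [this]
  rw [lintegral_mul_const _ (by fun_prop)]

/-- For `s > 1` and `0 ≤ r ≤ s`, multiplication maps `H^s × H^r` to `H^r` in the plane: the weighted
Fourier transform of the product is a convolution with a kernel, to which the Cauchy–Schwarz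
inequality is applied for each output frequency. -/
theorem enorm_bessel_schwartzMul_le {r s : ℝ} (hs : 1 < s) (hr : 0 ≤ r) (hrs : r ≤ s) :
    ∃ C : ℝ≥0, ∀ f g : 𝓢(Plane, ℂ), ‖(bessel r (schwartzMul f g)).toLp 2‖ₑ ≤
      C * (‖(bessel s f).toLp 2‖ₑ * ‖(bessel r g).toLp 2‖ₑ) := by
  have hIt : ∫⁻ ξ, ENNReal.ofReal (weight (-2 * s) ξ) ≠ ⊤ := (lintegral_weight_lt_top hs).ne
  have hK := fun ξ => lintegral_kernel_le hr hrs ξ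
  generalize ∫⁻ ξ, ENNReal.ofReal (weight (-2 * s) ξ) = I at hIt hK
  have hC2t : ENNReal.ofReal ((2 ^ r) ^ 2) * (I + I) ≠ ⊤ := by finiteness
  generalize ENNReal.ofReal ((2 ^ r) ^ 2) * (I + I) = C2 at hC2t hK
  refine ⟨NNReal.sqrt C2.toNNReal, fun f g => ?_⟩
  have hC : ((NNReal.sqrt C2.toNNReal : ℝ≥0) : ℝ≥0∞) ^ 2 = C2 := by
    rw [← ENNReal.coe_pow, NNReal.sq_sqrt, ENNReal.coe_toNNReal hC2t]
  rw [← ENNReal.pow_le_pow_left_iff (n := 2) (by norm_num), mul_pow, mul_pow, hC,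
    enorm_sq_bessel, enorm_sq_bessel, enorm_sq_bessel]
  have hP := fun ξ => enorm_fourierInv_schwartzMul_le r s f g ξ
  have mF : Measurable fun t => ENNReal.ofReal (weight s t) * ‖𝓕⁻ f t‖ₑ :=
    (measurable_weight s).ennreal_ofReal.mul (𝓕⁻ f).continuous.measurable.enorm
  have mG : Measurable fun t => ENNReal.ofReal (weight r t) * ‖𝓕⁻ g t‖ₑ :=
    (measurable_weight r).ennreal_ofReal.mul (𝓕⁻ g).continuous.measurable.enorm
  have mk : ∀ ξ, Measurable fun t =>
      ENNReal.ofReal (weight r ξ * (weight (-s) t * weight (-r) (ξ - t))) := fun ξ => by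
    have h2 : Measurable fun t => weight (-r) (ξ - t) := (measurable_weight (-r)).comp (by fun_prop)
    exact (((measurable_weight (-s)).mul h2).const_mul _).ennreal_ofReal
  rw [← lintegral_sq_convolution mF mG, ← lintegral_const_mul' _ _ hC2t]
  refine lintegral_mono fun ξ => ?_
  have mFG : Measurable fun t => (ENNReal.ofReal (weight s t) * ‖𝓕⁻ f t‖ₑ) *
      (ENNReal.ofReal (weight r (ξ - t)) * ‖𝓕⁻ g (ξ - t)‖ₑ) :=
    mF.mul (mG.comp (by fun_prop : Measurable fun t => ξ - t))
  calc _ ≤ _ := pow_le_pow_left' (hP ξ) 2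
    _ ≤ _ := sq_lintegral_mul_le volume (mk ξ).aemeasurable mFG.aemeasurable
    _ ≤ _ := by gcongr; exact hK ξ

end SchwartzEstimates

/-! ### Approximation by Schwartz functions -/

section Approximation

open FourierTransform

/-- `L²(ℝ²)` with complex values. -/
abbrev L2 : Type := Lp ℂ 2 (volume : Measure Plane)

/-- The Schwartz functions `f n` converge to `g` in `H^r(ℝ²)`, and `h` is the Bessel potential of
order `r` of the limit: both `f n → g` and `bessel r (f n) → h` in `L²`. -/
def Approximates (r : ℝ) (f : ℕ → 𝓢(Plane, ℂ)) (g h : L2) : Prop :=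
  Tendsto (fun n => (f n).toLp 2) atTop (𝓝 g) ∧
    Tendsto (fun n => (bessel r (f n)).toLp 2) atTop (𝓝 h)

lemma toLp_sub (f g : 𝓢(Plane, ℂ)) :
    ((f - g).toLp 2 : L2) = f.toLp 2 volume - g.toLp 2 volume :=
  map_sub (SchwartzMap.toLpCLM ℂ ℂ 2 volume) f g

lemma toLp_add (f g : 𝓢(Plane, ℂ)) :
    ((f + g).toLp 2 : L2) = f.toLp 2 volume + g.toLp 2 volume :=
  map_add (SchwartzMap.toLpCLM ℂ ℂ 2 volume) f g

/-- A bounded operator on Schwartz functions, relative to another one, preserves convergence. -/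
lemma exists_tendsto_of_enorm_le {A B : 𝓢(Plane, ℂ) →L[ℂ] 𝓢(Plane, ℂ)} {K : ℝ≥0}
    (hK : ∀ f, ‖(A f).toLp 2‖ₑ ≤ K * ‖(B f).toLp 2‖ₑ) {f : ℕ → 𝓢(Plane, ℂ)} {h : L2}
    (hf : Tendsto (fun n => (B (f n)).toLp 2) atTop (𝓝 h)) :
    ∃ d : L2, Tendsto (fun n => (A (f n)).toLp 2) atTop (𝓝 d) ∧ ‖d‖ₑ ≤ K * ‖h‖ₑ := by
  have hc : CauchySeq (fun n => (A (f n)).toLp 2 : ℕ → L2) := by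
    rw [EMetric.cauchySeq_iff]
    intro ε hε
    have h1 := hf.cauchySeq
    rw [EMetric.cauchySeq_iff] at h1
    obtain ⟨N, hN⟩ := h1 (ε / (K + 1)) (ENNReal.div_pos hε.ne' (by finiteness))
    refine ⟨N, fun m hm n hn => ?_⟩
    have h2 := hN m hm n hn
    have e : ∀ T : 𝓢(Plane, ℂ) →L[ℂ] 𝓢(Plane, ℂ),
        edist ((T (f m)).toLp 2 : L2) ((T (f n)).toLp 2) = ‖(T (f m - f n)).toLp 2‖ₑ := by
      intro T
      rw [edist_eq_enorm_sub, map_sub, toLp_sub]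
    rw [e] at h2 ⊢
    calc _ ≤ _ := hK _
      _ ≤ (K + 1) * _ := by gcongr; exact le_self_add
      _ < ε := by
        rw [mul_comm]
        exact (ENNReal.lt_div_iff_mul_lt (by simp) (by left; finiteness)).1 h2
  obtain ⟨d, hd⟩ := cauchySeq_tendsto_of_complete hc
  refine ⟨d, hd, ?_⟩
  refine le_of_tendsto_of_tendsto hd.enorm (ENNReal.Tendsto.const_mul hf.enorm ?_)
    (Eventually.of_forall fun n => hK _)
  right; finiteness

lemma besselPotential_schwartz (r : ℝ) (f : 𝓢(Plane, ℂ)) :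
    TemperedDistribution.besselPotential Plane ℂ r ((f.toLp 2 : L2) : 𝓢'(Plane, ℂ)) =
      ((bessel r f).toLp 2 : L2) := by
  rw [Lp.toTemperedDistribution_toLp_eq, Lp.toTemperedDistribution_toLp_eq]
  exact TemperedDistribution.fourierMultiplierCLM_toTemperedDistributionCLM_eq
    (weight_temperate r) f

/-- The graph of the distributional Bessel potential is closed in `L² × L²`. -/
lemma besselPotential_isClosed {r : ℝ} {ι : Type*} {l : Filter ι} [l.NeBot] {G H : ι → L2}
    {g h : L2} (hg : Tendsto G l (𝓝 g)) (hh : Tendsto H l (𝓝 h))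
    (e : ∀ n, TemperedDistribution.besselPotential Plane ℂ r (G n : 𝓢'(Plane, ℂ)) = H n) :
    TemperedDistribution.besselPotential Plane ℂ r (g : 𝓢'(Plane, ℂ)) = h := by
  have c := (Lp.toTemperedDistributionCLM (E := Plane) ℂ volume 2).continuous
  have h1 := ((TemperedDistribution.besselPotential Plane ℂ r).continuous.tendsto _).comp
    ((c.tendsto g).comp hg)
  have h2 := (c.tendsto h).comp hh
  refine tendsto_nhds_unique h1 (h2.congr fun n => ?_)
  exact (e n).symm

lemma Approximates.besselPotential_eq {r : ℝ} {f : ℕ → 𝓢(Plane, ℂ)} {g h : L2}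
    (H : Approximates r f g h) :
    TemperedDistribution.besselPotential Plane ℂ r (g : 𝓢'(Plane, ℂ)) = h :=
  besselPotential_isClosed H.1 H.2 fun n => besselPotential_schwartz r (f n)

lemma toTemperedDistribution_injective {g g' : L2}
    (h : (g : 𝓢'(Plane, ℂ)) = (g' : 𝓢'(Plane, ℂ))) : g = g' := by
  have := LinearMap.ker_eq_bot.1
    (Lp.ker_toTemperedDistributionCLM_eq_bot (E := Plane) (F := ℂ) (μ := volume) (p := 2))
  exact this h

/-- Schwartz functions are dense in `H^r(ℝ²)`: apply the Bessel potential of order `-r`, which is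
bounded on `L²`, to Schwartz functions approximating `h`. -/
lemma exists_approximates {r : ℝ} (hr : 0 ≤ r) {g h : L2}
    (e : TemperedDistribution.besselPotential Plane ℂ r (g : 𝓢'(Plane, ℂ)) = h) :
    ∃ f, Approximates r f g h := by
  obtain ⟨k, hk⟩ : ∃ k : ℕ → 𝓢(Plane, ℂ), Tendsto (fun n => ((k n).toLp 2 : L2)) atTop (𝓝 h) := by
    have hd := SchwartzMap.denseRange_toLpCLM (E := Plane) (F := ℂ) (μ := volume) (p := 2)
      ENNReal.ofNat_ne_top
    have := hd h
    obtain ⟨x, hx, hx2⟩ := mem_closure_iff_seq_limit.1 this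
    choose k hk using hx
    refine ⟨k, hx2.congr fun n => ?_⟩
    rw [← hk]; rfl
  have b : ∀ n, bessel r (bessel (-r) (k n)) = k n := fun n => by
    rw [bessel_bessel, add_neg_cancel, bessel_zero]
  have hB : ∀ f : 𝓢(Plane, ℂ), ‖(bessel (-r) f).toLp 2‖ₑ ≤
      ((1 : ℝ≥0) : ℝ≥0∞) * ‖((ContinuousLinearMap.id ℂ _ : 𝓢(Plane, ℂ) →L[ℂ] _) f).toLp 2‖ₑ := by
    intro f
    have := enorm_bessel_mono (r := -r) (s := 0) (by linarith) f
    rw [bessel_zero] at this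
    simpa using this
  obtain ⟨d, hd, -⟩ := exists_tendsto_of_enorm_le hB (f := k) (h := h) hk
  have happ : Approximates r (fun n => bessel (-r) (k n)) d h := ⟨hd, by simpa only [b] using hk⟩
  refine ⟨fun n => bessel (-r) (k n), ?_⟩
  convert happ
  apply toTemperedDistribution_injective
  have e2 := happ.besselPotential_eq
  rw [← e] at e2
  have e3 := congrArg (TemperedDistribution.besselPotential Plane ℂ (-r)) e2
  simpa using e3.symm

lemma Approximates.mono {r s : ℝ} (hrs : r ≤ s) {f : ℕ → 𝓢(Plane, ℂ)} {g h : L2}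
    (H : Approximates s f g h) : ∃ h', Approximates r f g h' ∧ ‖h'‖ₑ ≤ ‖h‖ₑ := by
  obtain ⟨d, hd, hd2⟩ := exists_tendsto_of_enorm_le (A := bessel r) (B := bessel s) (K := 1)
    (fun f => by simpa using enorm_bessel_mono hrs f) H.2
  exact ⟨d, ⟨H.1, hd⟩, by simpa using hd2⟩

lemma Approximates.enorm_le {r : ℝ} (hr : 0 ≤ r) {f : ℕ → 𝓢(Plane, ℂ)} {g h : L2}
    (H : Approximates r f g h) : ‖g‖ₑ ≤ ‖h‖ₑ := by
  refine le_of_tendsto_of_tendsto H.1.enorm H.2.enorm (Eventually.of_forall fun n => ?_)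
  have := enorm_bessel_mono hr (f n)
  rwa [bessel_zero] at this

lemma Approximates.add {r : ℝ} {f f' : ℕ → 𝓢(Plane, ℂ)} {g h g' h' : L2}
    (H : Approximates r f g h) (H' : Approximates r f' g' h') :
    Approximates r (fun n => f n + f' n) (g + g') (h + h') := by
  refine ⟨(H.1.add H'.1).congr fun n => ?_, (H.2.add H'.2).congr fun n => ?_⟩
  · exact (map_add (SchwartzMap.toLpCLM ℂ ℂ 2 volume) (f n) (f' n)).symm
  · rw [map_add]
    exact (map_add (SchwartzMap.toLpCLM ℂ ℂ 2 volume) _ _).symm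

/-- Convergence in `L²` gives convergence almost everywhere along a common subsequence. -/
lemma exists_subseq_tendsto_ae {α : Type*} [MeasurableSpace α] {μ : Measure α}
    {F : ℕ → Lp ℂ 2 μ} {g : Lp ℂ 2 μ} (h : Tendsto F atTop (𝓝 g)) :
    ∃ ns : ℕ → ℕ, StrictMono ns ∧ ∀ᵐ x ∂μ, Tendsto (fun n => F (ns n) x) atTop (𝓝 (g x)) :=
  (tendstoInMeasure_of_tendsto_Lp h).exists_seq_tendsto_ae

/-- A sequence of products of two convergent sequences is a Cauchy sequence. -/
lemma cauchySeq_of_bilinear_bound {E F G : Type*} [NormedAddCommGroup E] [NormedAddCommGroup F]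
    [NormedAddCommGroup G] {u : ℕ → E} {v : ℕ → F} {w : ℕ → G} {a : E} {b : F} (C : ℝ)
    (hu : Tendsto u atTop (𝓝 a)) (hv : Tendsto v atTop (𝓝 b))
    (h : ∀ m n, ‖w m - w n‖ ≤ C * (‖u m - u n‖ * ‖v m‖) + C * (‖u n‖ * ‖v m - v n‖)) :
    CauchySeq w := by
  rw [cauchySeq_iff_tendsto_dist_atTop_0]
  have t1 := cauchySeq_iff_tendsto_dist_atTop_0.1 hu.cauchySeq
  have t2 := cauchySeq_iff_tendsto_dist_atTop_0.1 hv.cauchySeq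
  have p1 : Tendsto (fun n : ℕ × ℕ => n.1) atTop atTop := by
    rw [← prod_atTop_atTop_eq]; exact tendsto_fst
  have p2 : Tendsto (fun n : ℕ × ℕ => n.2) atTop atTop := by
    rw [← prod_atTop_atTop_eq]; exact tendsto_snd
  have t3 := ((t1.mul (hv.norm.comp p1)).const_mul C).add
    (((hu.norm.comp p2).mul t2).const_mul C)
  simp only [zero_mul, mul_zero, add_zero] at t3
  refine squeeze_zero (fun _ => dist_nonneg) (fun n => ?_) t3
  simp only [dist_eq_norm, Function.comp_apply]
  exact h n.1 n.2

lemma norm_toLp_le_of_enorm_le {a b c : L2} {C : ℝ≥0} (h : ‖a‖ₑ ≤ C * (‖b‖ₑ * ‖c‖ₑ)) :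
    ‖a‖ ≤ C * (‖b‖ * ‖c‖) := by
  rw [← toReal_enorm a, ← toReal_enorm b, ← toReal_enorm c, ← ENNReal.toReal_mul,
    ← ENNReal.coe_toReal, ← ENNReal.toReal_mul]
  exact ENNReal.toReal_mono (by finiteness) h

/-- The product of an `H^s` function with an `H^r` function, with approximations. -/
lemma exists_mul_bound {r s : ℝ} (hs : 1 < s) (hr : 0 ≤ r) (hrs : r ≤ s) :
    ∃ C : ℝ≥0, ∀ (f f' : ℕ → 𝓢(Plane, ℂ)) (g h g' h' : L2), Approximates s f g h →
      Approximates r f' g' h' → ∃ p q : L2,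
        Approximates r (fun n => schwartzMul (f n) (f' n)) p q ∧
        (∀ᵐ x ∂(volume : Measure Plane), p x = g x * g' x) ∧ ‖q‖ₑ ≤ C * (‖h‖ₑ * ‖h'‖ₑ) := by
  obtain ⟨C, hC⟩ := enorm_bessel_schwartzMul_le hs hr hrs
  refine ⟨C, fun f f' g h g' h' H H' => ?_⟩
  have hc : CauchySeq (fun n => (bessel r (schwartzMul (f n) (f' n))).toLp 2 : ℕ → L2) := by
    refine cauchySeq_of_bilinear_bound (C : ℝ) H.2 H'.2 fun m n => ?_
    -- the product is split as usual, so that one factor is a difference in each summand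
    have e : schwartzMul (f m) (f' m) - schwartzMul (f n) (f' n) =
        schwartzMul (f m - f n) (f' m) + schwartzMul (f n) (f' m - f' n) := by
      ext x
      simp [schwartzMul_apply]
      ring
    rw [← toLp_sub, ← map_sub, e, map_add, toLp_add, ← toLp_sub, ← toLp_sub, ← map_sub, ← map_sub]
    exact (norm_add_le _ _).trans (add_le_add (norm_toLp_le_of_enorm_le (hC _ _))
      (norm_toLp_le_of_enorm_le (hC _ _)))
  obtain ⟨q, hq⟩ := cauchySeq_tendsto_of_complete hc
  obtain ⟨p, hp, -⟩ := exists_tendsto_of_enorm_le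
    (A := ContinuousLinearMap.id ℂ 𝓢(Plane, ℂ)) (B := bessel r) (K := 1)
    (fun f => by simpa [bessel_zero] using enorm_bessel_mono hr f) hq
  refine ⟨p, q, ⟨hp, hq⟩, ?_, ?_⟩
  -- the `L²` limit of the products is the product of the limits along a common subsequence
  · obtain ⟨n1, m1, a1⟩ := exists_subseq_tendsto_ae H.1
    obtain ⟨n2, m2, a2⟩ := exists_subseq_tendsto_ae (H'.1.comp m1.tendsto_atTop)
    obtain ⟨n3, m3, a3⟩ := exists_subseq_tendsto_ae
      ((hp.comp m1.tendsto_atTop).comp m2.tendsto_atTop)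
    have c1 := ae_all_iff.2 fun n => SchwartzMap.coeFn_toLp (f n) 2 (volume : Measure Plane)
    have c2 := ae_all_iff.2 fun n => SchwartzMap.coeFn_toLp (f' n) 2 (volume : Measure Plane)
    have c3 := ae_all_iff.2 fun n =>
      SchwartzMap.coeFn_toLp (schwartzMul (f n) (f' n)) 2 (volume : Measure Plane)
    filter_upwards [a1, a2, a3, c1, c2, c3] with x b1 b2 b3 d1 d2 d3
    simp only [Function.comp_apply, d1, d2, ContinuousLinearMap.id_apply, d3] at b1 b2 b3
    have t := ((b1.comp m2.tendsto_atTop).comp m3.tendsto_atTop).mul (b2.comp m3.tendsto_atTop)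
    exact tendsto_nhds_unique b3 t
  · refine le_of_tendsto_of_tendsto hq.enorm (ENNReal.Tendsto.const_mul
      (ENNReal.Tendsto.mul H.2.enorm (by right; finiteness) H'.2.enorm (by right; finiteness)) ?_)
      (Eventually.of_forall fun n => hC _ _)
    right; finiteness

end Approximation

/-! ### The norm of `H^r(Ω)` -/

section SobolevNorm

/-- The pair `(g, h)` witnesses `v ∈ H^r(Ω)`: `g` extends `v` and `h` is its Bessel potential. -/
structure IsExtension (r : ℝ) (Ω : Set Plane) (v : Plane → ℝ) (g h : L2) : Prop where
  bessel_eq : TemperedDistribution.besselPotential Plane ℂ r (g : 𝓢'(Plane, ℂ)) = h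
  ae_eq : ∀ᵐ x ∂(volume.restrict Ω), g x = (v x : ℂ)

variable {r s : ℝ} {Ω : Set Plane} {v w : Plane → ℝ}

lemma IsExtension.hsNorm_le {g h : L2} (H : IsExtension r Ω v g h) : hsNorm r Ω v ≤ ‖h‖ₑ := by
  unfold hsNorm
  exact iInf_le_of_le g (iInf_le_of_le h (iInf_le_of_le H.1 (iInf_le _ H.2)))

lemma exists_isExtension_of_hsNorm_lt {a : ℝ≥0∞} (h : hsNorm r Ω v < a) :
    ∃ g k, IsExtension r Ω v g k ∧ ‖k‖ₑ < a := by
  unfold hsNorm at h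
  simp only [iInf_lt_iff] at h
  obtain ⟨g, k, h1, h2, h3⟩ := h
  exact ⟨g, k, ⟨h1, h2⟩, h3⟩

lemma memHs_iff : MemHs r Ω v ↔ hsNorm r Ω v < ⊤ := by
  constructor
  · rintro ⟨g, ⟨h, hh⟩, hv⟩
    exact (IsExtension.hsNorm_le ⟨hh, hv⟩).trans_lt (by finiteness)
  · intro h
    obtain ⟨g, k, ⟨h1, h2⟩, -⟩ := exists_isExtension_of_hsNorm_lt h
    exact ⟨g, ⟨k, h1⟩, h2⟩

lemma hsNorm_congr (h : v =ᵐ[volume.restrict Ω] w) : hsNorm r Ω v = hsNorm r Ω w := by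
  have key : ∀ {v w : Plane → ℝ}, v =ᵐ[volume.restrict Ω] w → hsNorm r Ω v ≤ hsNorm r Ω w := by
    intro v w h
    refine le_of_forall_gt fun a ha => ?_
    obtain ⟨g, k, H, hk⟩ := exists_isExtension_of_hsNorm_lt ha
    have : IsExtension r Ω v g k := ⟨H.1, by filter_upwards [h, H.2] with x h1 h2; rw [h2, h1]⟩
    exact this.hsNorm_le.trans_lt hk
  exact le_antisymm (key h) (key h.symm)

lemma eLpNorm_le_hsNorm (hr : 0 ≤ r) :
    eLpNorm v 2 (volume.restrict Ω) ≤ hsNorm r Ω v := by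
  refine le_of_forall_gt fun a ha => ?_
  obtain ⟨g, k, H, hk⟩ := exists_isExtension_of_hsNorm_lt ha
  obtain ⟨f, hf⟩ := exists_approximates hr H.1
  refine lt_of_le_of_lt ?_ hk
  calc eLpNorm v 2 (volume.restrict Ω) = eLpNorm g 2 (volume.restrict Ω) := by
        apply eLpNorm_congr_norm_ae
        filter_upwards [H.2] with x hx
        simp [hx]
    _ ≤ eLpNorm g 2 volume := eLpNorm_restrict_le _ _ _ _
    _ = ‖g‖ₑ := (Lp.enorm_def g).symm
    _ ≤ _ := hf.enorm_le hr

lemma hsNorm_mono (hr : 0 ≤ r) (h : r ≤ s) : hsNorm r Ω v ≤ hsNorm s Ω v := by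
  refine le_of_forall_gt fun a ha => ?_
  obtain ⟨g, k, H, hk⟩ := exists_isExtension_of_hsNorm_lt ha
  obtain ⟨f, hf⟩ := exists_approximates (hr.trans h) H.1
  obtain ⟨k', h1, h2⟩ := hf.mono h
  exact (IsExtension.hsNorm_le ⟨h1.besselPotential_eq, H.2⟩).trans_lt (h2.trans_lt hk)

lemma MemHs.aestronglyMeasurable (h : MemHs r Ω v) :
    AEStronglyMeasurable v (volume.restrict Ω) := by
  obtain ⟨g, -, hv⟩ := h
  have h1 : AEStronglyMeasurable (fun x => (g x).re) (volume.restrict Ω) :=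
    (Complex.measurable_re.comp_aemeasurable
      (Lp.stronglyMeasurable g).measurable.aemeasurable).aestronglyMeasurable
  refine h1.congr ?_
  filter_upwards [hv] with x hx
  simp [hx]

lemma MemHs.memLp (hr : 0 ≤ r) (h : MemHs r Ω v) : MemLp v 2 (volume.restrict Ω) :=
  ⟨h.aestronglyMeasurable, (eLpNorm_le_hsNorm hr).trans_lt (memHs_iff.1 h)⟩

lemma hsNorm_zero : hsNorm r Ω (fun _ => 0) = 0 := by
  have : IsExtension r Ω (fun _ => 0) 0 0 := by
    refine ⟨?_, ?_⟩
    · rw [← Lp.toTemperedDistributionCLM_apply]; simp only [map_zero]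
    · filter_upwards [ae_restrict_of_ae (Lp.coeFn_zero ℂ 2 (volume : Measure Plane))] with x hx
      simp
  simpa using this.hsNorm_le

lemma ae_eq_zero_of_hsNorm_eq_zero (hr : 0 ≤ r) (h : hsNorm r Ω v = 0) :
    v =ᵐ[volume.restrict Ω] fun _ => 0 := by
  have h1 : MemHs r Ω v := memHs_iff.2 (by simp [h])
  have h2 : eLpNorm v 2 (volume.restrict Ω) = 0 := by
    simpa [h] using eLpNorm_le_hsNorm (r := r) (Ω := Ω) (v := v) hr
  exact (eLpNorm_eq_zero_iff h1.aestronglyMeasurable (by norm_num)).1 h2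

lemma hsNorm_smul_le (c : ℝ) : hsNorm r Ω (fun x => c * v x) ≤ ‖c‖ₑ * hsNorm r Ω v := by
  rcases eq_or_ne c 0 with rfl | hc
  · simp [hsNorm_zero]
  have hc' : ‖c‖ₑ ≠ 0 := by simpa using hc
  refine le_of_forall_gt fun a ha => ?_
  have h1 : hsNorm r Ω v < a / ‖c‖ₑ := by
    rw [ENNReal.lt_div_iff_mul_lt (by left; exact hc') (by left; finiteness), mul_comm]
    exact ha
  obtain ⟨g, k, H, hk⟩ := exists_isExtension_of_hsNorm_lt h1
  have : IsExtension r Ω (fun x => c * v x) ((c : ℂ) • g) ((c : ℂ) • k) := by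
    refine ⟨?_, ?_⟩
    · have := H.1
      rw [← Lp.toTemperedDistributionCLM_apply, ← Lp.toTemperedDistributionCLM_apply] at this ⊢
      rw [map_smul, map_smul, this, map_smul]
    · filter_upwards [H.2, ae_restrict_of_ae (Lp.coeFn_smul (c : ℂ) g)] with x hx h2
      rw [h2, Pi.smul_apply, hx]; simp
  refine this.hsNorm_le.trans_lt ?_
  rw [enorm_smul, mul_comm]
  have e : ‖(c : ℂ)‖ₑ = ‖c‖ₑ := by rw [enorm_eq_iff_norm_eq]; simp
  rw [e]
  exact (ENNReal.lt_div_iff_mul_lt (by left; exact hc') (by left; finiteness)).1 hk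

/-- Countable subadditivity of the Sobolev norm. Summability is not assumed: if the right-hand side
is finite, then almost optimal extensions can be summed. -/
lemma hsNorm_le_tsum (hr : 0 ≤ r) {V : ℕ → Plane → ℝ}
    (h : ∀ᵐ x ∂(volume.restrict Ω), HasSum (fun n => V n x) (v x)) :
    hsNorm r Ω v ≤ ∑' n, hsNorm r Ω (V n) := by
  rcases eq_or_ne (∑' n, hsNorm r Ω (V n)) ⊤ with htop | htop
  · simp [htop]
  refine ENNReal.le_of_forall_pos_le_add fun ε hε _ => ?_
  obtain ⟨δ, hδ, hδ2⟩ := ENNReal.exists_pos_sum_of_countable (ε := ε) (by simpa using hε.ne') ℕ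
  have hlt : ∀ n, hsNorm r Ω (V n) < hsNorm r Ω (V n) + δ n := fun n =>
    ENNReal.lt_add_right (ENNReal.ne_top_of_tsum_ne_top htop n) (by simpa using (hδ n).ne')
  choose g k H hk using fun n => exists_isExtension_of_hsNorm_lt (hlt n)
  have hsum : ∑' n, ‖k n‖ₑ ≤ ∑' n, hsNorm r Ω (V n) + ε := by
    calc _ ≤ ∑' n, (hsNorm r Ω (V n) + δ n) := ENNReal.tsum_le_tsum fun n => (hk n).le
      _ = _ + _ := ENNReal.tsum_add
      _ ≤ _ := by gcongr
  have hkt : ∑' n, ‖k n‖ₑ ≠ ⊤ := ne_top_of_le_ne_top (by finiteness) hsum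
  have hgk : ∀ n, ‖g n‖ₑ ≤ ‖k n‖ₑ := fun n => by
    obtain ⟨f, hf⟩ := exists_approximates hr (H n).1
    exact hf.enorm_le hr
  have hsummable : ∀ F : ℕ → L2, ∑' n, ‖F n‖ₑ ≠ ⊤ → Summable F := fun F hF => by
    apply Summable.of_nnnorm
    rw [← ENNReal.tsum_coe_ne_top_iff_summable]
    exact hF
  have sk := hsummable k hkt
  have sg := hsummable g (ne_top_of_le_ne_top hkt (ENNReal.tsum_le_tsum hgk))
  have hext : IsExtension r Ω v (∑' n, g n) (∑' n, k n) := by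
    have tg := sg.hasSum.tendsto_sum_nat
    refine ⟨besselPotential_isClosed tg sk.hasSum.tendsto_sum_nat fun n => ?_, ?_⟩
    · rw [← Lp.toTemperedDistributionCLM_apply, ← Lp.toTemperedDistributionCLM_apply, map_sum,
        map_sum, map_sum]
      refine Finset.sum_congr rfl fun i _ => ?_
      exact (H i).1
    · obtain ⟨ns, hns, a1⟩ := exists_subseq_tendsto_ae tg
      have c1 := ae_all_iff.2 fun n => ae_restrict_of_ae (s := Ω)
        (Lp.coeFn_finsetSum (Finset.range n) g)
      filter_upwards [ae_restrict_of_ae a1, c1, h, ae_all_iff.2 fun n => (H n).2]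
        with x b1 d1 hx e1
      simp only [d1, Finset.sum_apply, e1] at b1
      have t2 := (hx.tendsto_sum_nat.comp hns.tendsto_atTop)
      have t3 := (Complex.continuous_ofReal.tendsto _).comp t2
      refine tendsto_nhds_unique b1 (t3.congr fun n => ?_)
      simp
  refine hext.hsNorm_le.trans (le_trans ?_ hsum)
  exact enorm_tsum_le_tsum_enorm (f := k)

lemma hsNorm_add_le (hr : 0 ≤ r) :
    hsNorm r Ω (fun x => v x + w x) ≤ hsNorm r Ω v + hsNorm r Ω w := by
  have h := hsNorm_le_tsum (r := r) (Ω := Ω) (v := fun x => v x + w x)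
    (V := fun n => if n = 0 then v else if n = 1 then w else fun _ => 0) hr
    (Eventually.of_forall fun x => by
      have : HasSum (fun n => (if n = 0 then v else if n = 1 then w else fun _ => 0) x)
          (∑ n ∈ Finset.range 2, (if n = 0 then v else if n = 1 then w else fun _ => 0) x) := by
        refine hasSum_sum_of_ne_finset_zero fun b hb => ?_
        simp only [Finset.mem_range, not_lt] at hb
        simp [show b ≠ 0 by omega, show b ≠ 1 by omega]
      simpa [Finset.sum_range_succ] using this)
  refine h.trans (le_of_eq ?_)
  rw [tsum_eq_sum (s := Finset.range 2)]
  · simp [Finset.sum_range_succ]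
  · intro b hb
    simp only [Finset.mem_range, not_lt] at hb
    simp [show b ≠ 0 by omega, show b ≠ 1 by omega, hsNorm_zero]

/-- For `s > 1` and `0 ≤ r ≤ s`, `H^r(Ω)` is a module over the algebra `H^s(Ω)`, with a bound that
does not depend on `Ω`. -/
lemma exists_hsNorm_mul_le (hs : 1 < s) (hr : 0 ≤ r) (hrs : r ≤ s) :
    ∃ C : ℝ≥0, ∀ (Ω : Set Plane) (v w : Plane → ℝ),
      hsNorm r Ω (fun x => v x * w x) ≤ C * (hsNorm s Ω v * hsNorm r Ω w) := by
  obtain ⟨C, hC⟩ := exists_mul_bound hs hr hrs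
  -- the cases where the right-hand side might be the product `0 * ⊤ = 0` come first
  refine ⟨C + 1, fun Ω v w => ?_⟩
  rcases eq_or_ne (hsNorm s Ω v) 0 with h0 | h0
  · have := ae_eq_zero_of_hsNorm_eq_zero (by linarith) h0
    rw [hsNorm_congr (w := fun _ => 0) (by filter_upwards [this] with x hx; simp [hx]), hsNorm_zero]
    exact zero_le
  rcases eq_or_ne (hsNorm r Ω w) 0 with h0' | h0'
  · have := ae_eq_zero_of_hsNorm_eq_zero hr h0'
    rw [hsNorm_congr (w := fun _ => 0) (by filter_upwards [this] with x hx; simp [hx]), hsNorm_zero]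
    exact zero_le
  have hC0 : ((C + 1 : ℝ≥0) : ℝ≥0∞) ≠ 0 := by simp
  rcases eq_or_ne (hsNorm s Ω v) ⊤ with ht | ht
  · rw [ht, ENNReal.top_mul h0', ENNReal.mul_top hC0]; exact le_top
  rcases eq_or_ne (hsNorm r Ω w) ⊤ with ht' | ht'
  · rw [ht', ENNReal.mul_top h0, ENNReal.mul_top hC0]; exact le_top
  have key : ∀ a b : ℝ≥0∞, hsNorm s Ω v < a → hsNorm r Ω w < b →
      hsNorm r Ω (fun x => v x * w x) ≤ (C + 1 : ℝ≥0) * (a * b) := by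
    intro a b ha hb
    obtain ⟨g, k, H, hk⟩ := exists_isExtension_of_hsNorm_lt ha
    obtain ⟨g', k', H', hk'⟩ := exists_isExtension_of_hsNorm_lt hb
    obtain ⟨f, hf⟩ := exists_approximates (by linarith) H.1
    obtain ⟨f', hf'⟩ := exists_approximates hr H'.1
    obtain ⟨p, q, hpq, hp, hq⟩ := hC f f' g k g' k' hf hf'
    have : IsExtension r Ω (fun x => v x * w x) p q := by
      refine ⟨hpq.besselPotential_eq, ?_⟩
      filter_upwards [ae_restrict_of_ae hp, H.2, H'.2] with x h1 h2 h3
      rw [h1, h2, h3]; simp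
    refine this.hsNorm_le.trans (hq.trans ?_)
    gcongr
    simp
  have t1 : Tendsto (fun n : ℕ => hsNorm s Ω v + (n : ℝ≥0∞)⁻¹) atTop (𝓝 (hsNorm s Ω v + 0)) :=
    tendsto_const_nhds.add ENNReal.tendsto_inv_nat_nhds_zero
  have t2 : Tendsto (fun n : ℕ => hsNorm r Ω w + (n : ℝ≥0∞)⁻¹) atTop (𝓝 (hsNorm r Ω w + 0)) :=
    tendsto_const_nhds.add ENNReal.tendsto_inv_nat_nhds_zero
  rw [add_zero] at t1 t2
  refine ge_of_tendsto (ENNReal.Tendsto.const_mul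
    (ENNReal.Tendsto.mul t1 (by right; exact ht') t2 (by right; exact ht)) (by right; finiteness))
    (Eventually.of_forall fun n => key _ _ ?_ ?_)
  · exact ENNReal.lt_add_right ht (by simp)
  · exact ENNReal.lt_add_right ht' (by simp)

end SobolevNorm

/-! ### Weak partial derivatives of `H^s` fields -/

section WeakDerivatives

variable {r s : ℝ} {Ω : Set Plane} {v w v' w' : Plane → ℝ} {k : Fin 2}

open LineDeriv

/-- The `k`-th partial derivative of a Schwartz function. -/
noncomputable abbrev partialDeriv (k : Fin 2) (f : 𝓢(Plane, ℂ)) : 𝓢(Plane, ℂ) := ∂_{unitVec k} f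

/-- `v ∈ H^s(Ω)` with partial derivative `w = ∂ₖ v ∈ L²(Ω)`: there are Schwartz functions which
converge to an extension of `v` in `H^s(ℝ²)` and whose partial derivatives converge to an extension
of `w` in `L²(ℝ²)`. -/
def HasSobolevPartial (s : ℝ) (Ω : Set Plane) (k : Fin 2) (v w : Plane → ℝ) : Prop :=
  ∃ (f : ℕ → 𝓢(Plane, ℂ)) (g h d : L2), Approximates s f g h ∧
    Tendsto (fun n => ((partialDeriv k (f n)).toLp 2 : L2)) atTop (𝓝 d) ∧
    (∀ᵐ x ∂(volume.restrict Ω), g x = (v x : ℂ)) ∧ ∀ᵐ x ∂(volume.restrict Ω), d x = (w x : ℂ)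

lemma Approximates.exists_partialDeriv (hs : 1 ≤ s) {f : ℕ → 𝓢(Plane, ℂ)} {g h : L2}
    (H : Approximates s f g h) (k : Fin 2) :
    ∃ d : L2, Tendsto (fun n => ((partialDeriv k (f n)).toLp 2 : L2)) atTop (𝓝 d) := by
  obtain ⟨d, hd, -⟩ := exists_tendsto_of_enorm_le
    (A := lineDerivOpCLM ℂ 𝓢(Plane, ℂ) (unitVec k)) (B := bessel s)
    (fun f => enorm_lineDeriv_le hs k f) H.2
  exact ⟨d, hd⟩

/-- A real test function as a complex-valued Schwartz function. -/
noncomputable def testSchwartz (φ : Plane → ℝ) (h1 : ContDiff ℝ ∞ φ) (h2 : HasCompactSupport φ) :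
    𝓢(Plane, ℂ) :=
  HasCompactSupport.toSchwartzMap (f := fun x => (φ x : ℂ))
    (h2.comp_left (g := fun t : ℝ => (t : ℂ)) Complex.ofReal_zero)
    (Complex.ofRealCLM.contDiff.comp h1)

lemma testSchwartz_apply {φ : Plane → ℝ} (h1 : ContDiff ℝ ∞ φ) (h2 : HasCompactSupport φ)
    (x : Plane) : testSchwartz φ h1 h2 x = (φ x : ℂ) := rfl

lemma partialDeriv_testSchwartz {φ : Plane → ℝ} (h1 : ContDiff ℝ ∞ φ) (h2 : HasCompactSupport φ)
    (k : Fin 2) (x : Plane) : partialDeriv k (testSchwartz φ h1 h2) x =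
      ((fderiv ℝ φ x (EuclideanSpace.single k 1) : ℝ) : ℂ) := by
  rw [SchwartzMap.lineDerivOp_apply_eq_fderiv]
  have h3 : HasFDerivAt φ (fderiv ℝ φ x) x :=
    ((h1.differentiable (by simp)) x).hasFDerivAt
  have h4 : HasFDerivAt (fun y => (φ y : ℂ)) (Complex.ofRealCLM.comp (fderiv ℝ φ x)) x :=
    Complex.ofRealCLM.hasFDerivAt.comp x h3
  have : (⇑(testSchwartz φ h1 h2) : Plane → ℂ) = fun y => (φ y : ℂ) := rfl
  rw [this, h4.fderiv]
  rfl

lemma tendsto_integral_mul {F : ℕ → L2} {g : L2} (h : Tendsto F atTop (𝓝 g)) (ψ : 𝓢(Plane, ℂ))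
    (hψ : ∀ x, star (ψ x) = ψ x) :
    Tendsto (fun n => ∫ x, F n x * ψ x) atTop (𝓝 (∫ x, g x * ψ x)) := by
  have key : ∀ G : L2, ∫ x, G x * ψ x = inner ℂ (ψ.toLp 2 : L2) G := by
    intro G
    rw [L2.inner_def]
    refine integral_congr_ae ?_
    filter_upwards [SchwartzMap.coeFn_toLp ψ 2 (volume : Measure Plane)] with x hx
    rw [hx, RCLike.inner_apply]
    congr 1
    exact (hψ x).symm
  simp only [key]
  exact tendsto_const_nhds.inner h

/-- Integration by parts for the limit of a sequence of Schwartz functions. -/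
lemma integral_mul_partialDeriv {f : ℕ → 𝓢(Plane, ℂ)} {g d : L2}
    (hg : Tendsto (fun n => ((f n).toLp 2 : L2)) atTop (𝓝 g))
    (hd : Tendsto (fun n => ((partialDeriv k (f n)).toLp 2 : L2)) atTop (𝓝 d))
    {φ : Plane → ℝ} (h1 : ContDiff ℝ ∞ φ) (h2 : HasCompactSupport φ) :
    ∫ x, g x * ((fderiv ℝ φ x (EuclideanSpace.single k 1) : ℝ) : ℂ) =
      -∫ x, d x * (φ x : ℂ) := by
  have t1 := tendsto_integral_mul hg (partialDeriv k (testSchwartz φ h1 h2)) (fun x => by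
    rw [partialDeriv_testSchwartz]; exact Complex.conj_ofReal _)
  have t2 := (tendsto_integral_mul hd (testSchwartz φ h1 h2) (fun x => by
    rw [testSchwartz_apply]; exact Complex.conj_ofReal _)).neg
  simp only [partialDeriv_testSchwartz, testSchwartz_apply] at t1 t2
  refine tendsto_nhds_unique t1 (t2.congr fun n => ?_)
  have := SchwartzMap.integral_mul_lineDerivOp_right_eq_neg_left (μ := volume) (f n)
    (testSchwartz φ h1 h2) (unitVec k)
  have e1 : ∀ F : 𝓢(Plane, ℂ), ∀ ψ : Plane → ℂ, ∫ x, (F.toLp 2 : L2) x * ψ x = ∫ x, F x * ψ x := by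
    intro F ψ
    refine integral_congr_ae ?_
    filter_upwards [SchwartzMap.coeFn_toLp F 2 (volume : Measure Plane)] with x hx
    rw [hx]
  rw [e1, e1]
  simp only [← partialDeriv_testSchwartz h1 h2, ← testSchwartz_apply h1 h2]
  exact this.symm

lemma setIntegral_test {F : Plane → ℂ} {φ : Plane → ℝ} (hφ : Function.support φ ⊆ Ω) :
    ∫ x in Ω, F x * (φ x : ℂ) = ∫ x, F x * (φ x : ℂ) := by
  refine setIntegral_eq_integral_of_forall_compl_eq_zero fun x hx => ?_
  have : φ x = 0 := by
    by_contra h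
    exact hx (hφ h)
  simp [this]

lemma support_fderiv_subset_of_tsupport {φ : Plane → ℝ} (h : tsupport φ ⊆ Ω) (e : Plane) :
    Function.support (fun x => fderiv ℝ φ x e) ⊆ Ω := by
  refine fun x hx => h (support_fderiv_subset ℝ (f := φ) (fun h0 => hx ?_))
  simp [h0]

lemma locallyIntegrableOn_of_ae_eq {g : L2} (h : ∀ᵐ x ∂(volume.restrict Ω), g x = (v x : ℂ)) :
    LocallyIntegrableOn v Ω := by
  have h1 : MemLp (fun x => (g x).re) 2 (volume.restrict Ω) :=
    ((Lp.memLp g).restrict Ω).re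
  have h2 : MemLp v 2 (volume.restrict Ω) := h1.ae_eq (by
    filter_upwards [h] with x hx; simp [hx])
  exact locallyIntegrableOn_of_locallyIntegrable_restrict (h2.locallyIntegrable (by norm_num))

lemma integral_ofReal_mul {g : L2} (h : ∀ᵐ x ∂(volume.restrict Ω), g x = (v x : ℂ))
    (ψ : Plane → ℝ) :
    ∫ x in Ω, g x * (ψ x : ℂ) = ((∫ x in Ω, v x * ψ x : ℝ) : ℂ) := by
  rw [← integral_complex_ofReal]
  refine integral_congr_ae ?_
  filter_upwards [h] with x hx
  simp [hx]

lemma HasSobolevPartial.hasWeakPartial (H : HasSobolevPartial s Ω k v w) :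
    HasWeakPartial Ω k v w := by
  obtain ⟨f, g, h, d, H1, H2, H3, H4⟩ := H
  refine ⟨locallyIntegrableOn_of_ae_eq H3, locallyIntegrableOn_of_ae_eq H4, ?_⟩
  intro φ h1 h2 h3
  have := integral_mul_partialDeriv H1.1 H2 h1 h2
  rw [← setIntegral_test (support_fderiv_subset_of_tsupport h3 _),
    ← setIntegral_test ((subset_tsupport φ).trans h3), integral_ofReal_mul H3,
    integral_ofReal_mul H4] at this
  exact_mod_cast this

lemma integrableOn_mul_test {F : Plane → ℂ} (hF : LocallyIntegrableOn F Ω) {φ : Plane → ℝ}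
    (h1 : Continuous φ) (h2 : HasCompactSupport φ) (h3 : tsupport φ ⊆ Ω) :
    Integrable (fun x => F x * (φ x : ℂ)) := by
  have a1 : IntegrableOn (fun x => F x * (φ x : ℂ)) (tsupport φ) :=
    (hF.integrableOn_compact_subset h3 h2).mul_continuousOn (by fun_prop) h2
  rw [integrableOn_iff_integrable_of_support_subset] at a1
  · exact a1
  · intro x hx
    apply subset_tsupport φ
    intro h0
    simp [h0] at hx

/-- Weak partial derivatives of `H^s` fields, `s ≥ 1`, are the limits of the derivatives of
approximating Schwartz functions, because weak derivatives are unique. -/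
lemma HasWeakPartial.hasSobolevPartial (hΩ : IsOpen Ω) (hs : 1 ≤ s)
    (hv : MemHs s Ω v) (H : HasWeakPartial Ω k v w) : HasSobolevPartial s Ω k v w := by
  obtain ⟨g, ⟨h, hh⟩, hg⟩ := hv
  obtain ⟨f, hf⟩ := exists_approximates (by linarith) hh
  obtain ⟨d, hd⟩ := hf.exists_partialDeriv hs k
  refine ⟨f, g, h, d, hf, hd, hg, ?_⟩
  have ld : LocallyIntegrableOn (fun x => d x) Ω :=
    ((Lp.memLp d).locallyIntegrable (by norm_num)).locallyIntegrableOn Ω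
  have lw : LocallyIntegrableOn (fun x => (w x : ℂ)) Ω := fun x hx => by
    obtain ⟨t, ht, hi⟩ := H.2.1 x hx
    exact ⟨t, ht, hi.ofReal⟩
  have key : ∀ᵐ x, x ∈ Ω → d x - (w x : ℂ) = 0 := by
    refine hΩ.ae_eq_zero_of_integral_contDiff_smul_eq_zero (ld.sub lw) fun φ h1 h2 h3 => ?_
    have e1 := integral_mul_partialDeriv hf.1 hd h1 h2
    have e2 := H.2.2 φ h1 h2 h3
    rw [← setIntegral_test (support_fderiv_subset_of_tsupport h3 _), integral_ofReal_mul hg,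
      e2] at e1
    have i1 := integrableOn_mul_test ld h1.continuous h2 h3
    have i2 := integrableOn_mul_test lw h1.continuous h2 h3
    have e3 : ∫ x, (w x : ℂ) * (φ x : ℂ) = ((∫ x in Ω, w x * φ x : ℝ) : ℂ) := by
      rw [← setIntegral_test ((subset_tsupport φ).trans h3), ← integral_complex_ofReal]
      simp
    calc ∫ x, φ x • (d x - (w x : ℂ)) = ∫ x, (d x * (φ x : ℂ) - (w x : ℂ) * (φ x : ℂ)) := by
          congr 1 with x
          rw [Complex.real_smul]; ring
      _ = 0 := by
          rw [integral_sub i1 i2, e3, sub_eq_zero]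
          push_cast at e1
          exact (neg_injective e1).symm
  rw [ae_restrict_iff' hΩ.measurableSet]
  filter_upwards [key] with x hx hxΩ
  exact sub_eq_zero.1 (hx hxΩ)

lemma partialDeriv_schwartzMul (k : Fin 2) (f g : 𝓢(Plane, ℂ)) (x : Plane) :
    partialDeriv k (schwartzMul f g) x = partialDeriv k f x * g x + f x * partialDeriv k g x := by
  simp only [SchwartzMap.lineDerivOp_apply_eq_fderiv]
  have : (⇑(schwartzMul f g) : Plane → ℂ) = fun y => f y * g y := rfl
  rw [this, fderiv_fun_mul f.differentiableAt g.differentiableAt]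
  simp
  ring

/-- The product rule in `H^s(Ω)`, `s > 1`. -/
lemma HasSobolevPartial.mul (hs : 1 < s) (H : HasSobolevPartial s Ω k v w)
    (H' : HasSobolevPartial s Ω k v' w') :
    HasSobolevPartial s Ω k (fun x => v x * v' x) (fun x => w x * v' x + v x * w' x) := by
  obtain ⟨f, g, h, d, H1, H2, H3, H4⟩ := H
  obtain ⟨f', g', h', d', H1', H2', H3', H4'⟩ := H'
  obtain ⟨C, hC⟩ := exists_mul_bound hs (by linarith : 0 ≤ s) le_rfl
  obtain ⟨p, q, hpq, hp, -⟩ := hC f f' g h g' h' H1 H1'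
  obtain ⟨e, he⟩ := hpq.exists_partialDeriv hs.le k
  refine ⟨_, p, q, e, hpq, he, ?_, ?_⟩
  · filter_upwards [ae_restrict_of_ae hp, H3, H3'] with x h1 h2 h3
    rw [h1, h2, h3]; simp
  · have key : ∀ᵐ x ∂(volume : Measure Plane), e x = d x * g' x + g x * d' x := by
      obtain ⟨n1, m1, a1⟩ := exists_subseq_tendsto_ae H1.1
      obtain ⟨n2, m2, a2⟩ := exists_subseq_tendsto_ae (H1'.1.comp m1.tendsto_atTop)
      have m12 := m1.tendsto_atTop.comp m2.tendsto_atTop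
      obtain ⟨n3, m3, a3⟩ := exists_subseq_tendsto_ae (H2.comp m12)
      have m123 := m12.comp m3.tendsto_atTop
      obtain ⟨n4, m4, a4⟩ := exists_subseq_tendsto_ae (H2'.comp m123)
      have m1234 := m123.comp m4.tendsto_atTop
      obtain ⟨n5, m5, a5⟩ := exists_subseq_tendsto_ae (he.comp m1234)
      have c := fun F : ℕ → 𝓢(Plane, ℂ) =>
        ae_all_iff.2 fun n => SchwartzMap.coeFn_toLp (F n) 2 (volume : Measure Plane)
      filter_upwards [a1, a2, a3, a4, a5, c f, c f', c fun n => partialDeriv k (f n),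
        c fun n => partialDeriv k (f' n), c fun n => partialDeriv k (schwartzMul (f n) (f' n))]
        with x b1 b2 b3 b4 b5 d1 d2 d3 d4 d5
      simp only [Function.comp_apply, d1, d2, d3, d4, d5, partialDeriv_schwartzMul]
        at b1 b2 b3 b4 b5
      have t5 := m5.tendsto_atTop
      have t45 := m4.tendsto_atTop.comp t5
      have t345 := m3.tendsto_atTop.comp t45
      have t2345 := m2.tendsto_atTop.comp t345
      have t := ((b3.comp t45).mul (b2.comp t345)).add ((b1.comp t2345).mul (b4.comp t5))
      exact tendsto_nhds_unique b5 t
    filter_upwards [ae_restrict_of_ae key, H3, H3', H4, H4'] with x h1 h2 h3 h4 h5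
    rw [h1, h2, h3, h4, h5]; push_cast; ring

lemma HasSobolevPartial.add (H : HasSobolevPartial s Ω k v w)
    (H' : HasSobolevPartial s Ω k v' w') :
    HasSobolevPartial s Ω k (fun x => v x + v' x) (fun x => w x + w' x) := by
  obtain ⟨f, g, h, d, H1, H2, H3, H4⟩ := H
  obtain ⟨f', g', h', d', H1', H2', H3', H4'⟩ := H'
  refine ⟨_, _, _, d + d', H1.add H1', (H2.add H2').congr fun n => ?_, ?_, ?_⟩
  · rw [← toLp_add, partialDeriv, partialDeriv, partialDeriv, lineDerivOp_add]
  · filter_upwards [ae_restrict_of_ae (Lp.coeFn_add g g'), H3, H3'] with x h1 h2 h3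
    rw [h1, Pi.add_apply, h2, h3]; simp
  · filter_upwards [ae_restrict_of_ae (Lp.coeFn_add d d'), H4, H4'] with x h1 h2 h3
    rw [h1, Pi.add_apply, h2, h3]; simp

/-- Constants belong to `H^s(Ω)` because `Ω` is bounded. -/
lemma hasSobolevPartial_const (hΩ : Bornology.IsBounded Ω) (hm : MeasurableSet Ω) (c : ℝ) :
    HasSobolevPartial s Ω k (fun _ => c) (fun _ => 0) := by
  obtain ⟨R, hR, hΩR⟩ := hΩ.subset_ball_lt 0 0
  let χ : ContDiffBump (0 : Plane) := ⟨R, R + 1, hR, by linarith⟩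
  have c1 : ContDiff ℝ ∞ fun x => c * χ x := contDiff_const.mul χ.contDiff
  have c2 : HasCompactSupport fun x => c * χ x := χ.hasCompactSupport.mul_left
  let ψ := testSchwartz _ c1 c2
  refine ⟨fun _ => ψ, _, _, _, ⟨tendsto_const_nhds, tendsto_const_nhds⟩, tendsto_const_nhds,
    ?_, ?_⟩
  · rw [ae_restrict_iff' hm]
    filter_upwards [SchwartzMap.coeFn_toLp ψ 2 (volume : Measure Plane)] with x hx hxΩ
    rw [hx, testSchwartz_apply,
      χ.one_of_mem_closedBall (Metric.ball_subset_closedBall (hΩR hxΩ)), mul_one]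
  · rw [ae_restrict_iff' hm]
    filter_upwards [SchwartzMap.coeFn_toLp (partialDeriv k ψ) 2 (volume : Measure Plane)]
      with x hx hxΩ
    rw [hx, partialDeriv_testSchwartz]
    have : (fun x => c * χ x) =ᶠ[𝓝 x] fun _ => c := by
      filter_upwards [Metric.isOpen_ball.mem_nhds (hΩR hxΩ)] with y hy
      rw [χ.one_of_mem_closedBall (Metric.ball_subset_closedBall hy), mul_one]
    rw [this.fderiv_eq]
    simp

lemma HasSobolevPartial.memHs (H : HasSobolevPartial s Ω k v w) : MemHs s Ω v := by
  obtain ⟨f, g, h, d, H1, H2, H3, H4⟩ := H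
  exact ⟨g, ⟨h, H1.besselPotential_eq⟩, H3⟩

lemma HasSobolevPartial.memHs_zero_right (H : HasSobolevPartial s Ω k v w) : MemHs 0 Ω w := by
  obtain ⟨f, g, h, d, H1, H2, H3, H4⟩ := H
  exact ⟨d, ⟨d, by simp⟩, H4⟩

/-- Weak partial derivatives pass to limits in `L²(Ω)`. -/
lemma HasWeakPartial.of_tendsto {V W : ℕ → Plane → ℝ} (H : ∀ n, HasWeakPartial Ω k (V n) (W n))
    (hV : ∀ n, MemLp (V n) 2 (volume.restrict Ω)) (hW : ∀ n, MemLp (W n) 2 (volume.restrict Ω))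
    (hv : MemLp v 2 (volume.restrict Ω)) (hw : MemLp w 2 (volume.restrict Ω))
    (tv : Tendsto (fun n => eLpNorm (V n - v) 2 (volume.restrict Ω)) atTop (𝓝 0))
    (tw : Tendsto (fun n => eLpNorm (W n - w) 2 (volume.restrict Ω)) atTop (𝓝 0)) :
    HasWeakPartial Ω k v w := by
  refine ⟨locallyIntegrableOn_of_locallyIntegrable_restrict (hv.locallyIntegrable (by norm_num)),
    locallyIntegrableOn_of_locallyIntegrable_restrict (hw.locallyIntegrable (by norm_num)), ?_⟩
  intro φ h1 h2 h3
  have key : ∀ (F : ℕ → Plane → ℝ) (f ψ : Plane → ℝ), (∀ n, MemLp (F n) 2 (volume.restrict Ω)) →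
      MemLp f 2 (volume.restrict Ω) → MemLp ψ 2 (volume.restrict Ω) →
      Tendsto (fun n => eLpNorm (F n - f) 2 (volume.restrict Ω)) atTop (𝓝 0) →
      Tendsto (fun n => ∫ x in Ω, F n x * ψ x) atTop (𝓝 (∫ x in Ω, f x * ψ x)) := by
    intro F f ψ hF hf hψ ht
    refine tendsto_integral_of_L1' _ (hf.integrable_mul hψ).aestronglyMeasurable
      (Eventually.of_forall fun n => (hF n).integrable_mul hψ) ?_
    have t := ENNReal.Tendsto.mul_const ht (b := eLpNorm ψ 2 (volume.restrict Ω))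
      (by right; exact hψ.2.ne)
    rw [zero_mul] at t
    refine tendsto_of_tendsto_of_tendsto_of_le_of_le tendsto_const_nhds t
      (fun _ => zero_le) (fun n => ?_)
    have := eLpNorm_smul_le_mul_eLpNorm (p := 2) (q := 2) (r := 1) (f := ψ) (φ := F n - f)
      (μ := volume.restrict Ω) hψ.1 ((hF n).sub hf).1
    refine le_trans (le_of_eq ?_) this
    congr 1
    ext x
    simp [sub_mul]
  have m1 : MemLp φ 2 (volume.restrict Ω) :=
    (h1.continuous.memLp_of_hasCompactSupport h2).restrict Ω
  have m2 : MemLp (fun x => fderiv ℝ φ x (EuclideanSpace.single k 1)) 2 (volume.restrict Ω) := by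
    refine (Continuous.memLp_of_hasCompactSupport ?_ ?_).restrict Ω
    · exact (h1.continuous_fderiv (by simp)).clm_apply continuous_const
    · exact h2.fderiv_apply ℝ _
  refine tendsto_nhds_unique (key V v _ hV hv m2 tv) ?_
  refine (key W w φ hW hw m1 tw).neg.congr fun n => ?_
  exact ((H n).2.2 φ h1 h2 h3).symm

end WeakDerivatives

/-! ### The derivative of the matrix exponential -/

section MatrixExponential

open scoped Nat

/-- The derivative of `A ↦ A ^ (n + 1)` in the direction `X`, with the powers to the right of `X`
taken from a second argument `B`: it is `∑ k ≤ n, A ^ k * X * B ^ (n - k)`. -/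
def powDeriv {R : Type*} [Ring R] (A B X : R) : ℕ → R
  | 0 => X
  | n + 1 => powDeriv A B X n * B + A ^ (n + 1) * X

section Ring

variable {R : Type*} [Ring R] (A B X Y : R) (n : ℕ)

lemma powDeriv_succ : powDeriv A B X (n + 1) = powDeriv A B X n * B + A ^ (n + 1) * X := rfl

/-- The sum telescopes on polarized commutators. -/
lemma powDeriv_commutator :
    powDeriv A B (A * Y - Y * B) n = A ^ (n + 1) * Y - Y * B ^ (n + 1) := by
  induction n with
  | zero => simp [powDeriv]
  | succ n ih => rw [powDeriv_succ, ih, pow_succ A (n + 1), pow_succ B (n + 1)]; noncomm_ring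

lemma powDeriv_of_commute {A X : R} (h : Commute A X) (n : ℕ) :
    powDeriv A A X n = (n + 1) • (X * A ^ n) := by
  induction n with
  | zero => simp [powDeriv]
  | succ n ih =>
    rw [powDeriv_succ, ih, (h.pow_left (n + 1)).eq, smul_mul_assoc, mul_assoc, ← pow_succ,
      ← succ_nsmul]

lemma powDeriv_add : powDeriv A B (X + Y) n = powDeriv A B X n + powDeriv A B Y n := by
  induction n with
  | zero => simp [powDeriv]
  | succ n ih => rw [powDeriv_succ, powDeriv_succ, powDeriv_succ, ih]; noncomm_ring

lemma powDeriv_smul [Algebra ℝ R] (c : ℝ) : powDeriv A B (c • X) n = c • powDeriv A B X n := by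
  induction n with
  | zero => simp [powDeriv]
  | succ n ih => rw [powDeriv_succ, powDeriv_succ, ih]; simp

lemma powDeriv_apply {ι : Type*} (A B X : ι → R) (n : ℕ) (x : ι) :
    powDeriv A B X n x = powDeriv (A x) (B x) (X x) n := by
  induction n with
  | zero => rfl
  | succ n ih => rw [powDeriv_succ, powDeriv_succ, Pi.add_apply, Pi.mul_apply, ih]; rfl

end Ring

lemma hasSum_of_eq {f g : ℕ → Mat} {a : Mat} (h : HasSum f a) (e : ∀ n, g n = f n) :
    HasSum g a := by
  rwa [funext e]

/-- The derivative of the matrix exponential at `A` in the direction `X`, polarized: in its power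
series the factors to the right of `X` are taken from `B`. -/
noncomputable def dexp (A B X : Mat) : Mat := ∑' n : ℕ, ((n + 1)! : ℝ)⁻¹ • powDeriv A B X n

section Norm

open scoped Matrix.Norms.Operator

lemma norm_powDeriv_le (A B X : Mat) {m : ℝ} (hA : ‖A‖ ≤ m) (hB : ‖B‖ ≤ m) (n : ℕ) :
    ‖powDeriv A B X n‖ ≤ (n + 1) * (m ^ n * ‖X‖) := by
  have hm : 0 ≤ m := (norm_nonneg A).trans hA
  have hpow : ∀ n : ℕ, ‖A ^ n * X‖ ≤ m ^ n * ‖X‖ := by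
    intro n
    induction n with
    | zero => simp
    | succ n ih =>
      rw [pow_succ', mul_assoc]
      refine (norm_mul_le _ _).trans ?_
      rw [pow_succ', mul_assoc]
      gcongr
  induction n with
  | zero => simp [powDeriv]
  | succ n ih =>
    rw [powDeriv_succ]
    refine (norm_add_le _ _).trans ?_
    have h1 : ‖powDeriv A B X n * B‖ ≤ ((n + 1) * (m ^ n * ‖X‖)) * m :=
      (norm_mul_le _ _).trans (by gcongr)
    have h2 := hpow (n + 1)
    calc _ ≤ ((n + 1) * (m ^ n * ‖X‖)) * m + m ^ (n + 1) * ‖X‖ := add_le_add h1 h2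
      _ = _ := by push_cast; ring

lemma summable_dexp (A B X : Mat) :
    Summable fun n : ℕ => ((n + 1)! : ℝ)⁻¹ • powDeriv A B X n := by
  set m := max ‖A‖ ‖B‖ with hm
  have hm0 : 0 ≤ m := (norm_nonneg A).trans (le_max_left _ _)
  refine Summable.of_norm_bounded (g := fun n : ℕ => m ^ n / n ! * ‖X‖)
    ((Real.summable_pow_div_factorial m).mul_right _) fun n => ?_
  have h := norm_powDeriv_le A B X (le_max_left ‖A‖ ‖B‖) (le_max_right ‖A‖ ‖B‖) n
  rw [norm_smul, norm_inv, Real.norm_natCast]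
  calc _ ≤ ((n + 1)! : ℝ)⁻¹ * ((n + 1) * (m ^ n * ‖X‖)) := by gcongr
    _ = _ := by
      rw [Nat.factorial_succ]; push_cast
      field_simp

lemma hasSum_exp (A : Mat) : HasSum (fun n : ℕ => (n ! : ℝ)⁻¹ • A ^ n) (NormedSpace.exp A) :=
  NormedSpace.exp_series_hasSum_exp' A

lemma hasSum_exp_succ (A : Mat) :
    HasSum (fun n : ℕ => ((n + 1)! : ℝ)⁻¹ • A ^ (n + 1)) (NormedSpace.exp A - 1) := by
  have := (hasSum_nat_add_iff' 1).2 (hasSum_exp A)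
  simpa using this

end Norm

lemma hasSum_dexp (A B X : Mat) :
    HasSum (fun n : ℕ => ((n + 1)! : ℝ)⁻¹ • powDeriv A B X n) (dexp A B X) :=
  (summable_dexp A B X).hasSum

lemma dexp_add (A B X Y : Mat) : dexp A B (X + Y) = dexp A B X + dexp A B Y := by
  refine (hasSum_dexp A B (X + Y)).unique ?_
  simpa only [powDeriv_add, smul_add] using (hasSum_dexp A B X).add (hasSum_dexp A B Y)

lemma dexp_smul (A B X : Mat) (c : ℝ) : dexp A B (c • X) = c • dexp A B X := by
  refine (hasSum_dexp A B (c • X)).unique ?_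
  have := (hasSum_dexp A B X).const_smul c
  simp only [powDeriv_smul]
  convert this using 2
  rw [smul_comm]

lemma dexp_sub (A B X Y : Mat) : dexp A B (X - Y) = dexp A B X - dexp A B Y := by
  rw [eq_sub_iff_add_eq, ← dexp_add, sub_add_cancel]

lemma dexp_zero (A B : Mat) : dexp A B 0 = 0 := by
  simpa using dexp_sub A B 0 0

lemma dexp_sum (A B : Mat) {ι : Type*} (t : Finset ι) (X : ι → Mat) :
    dexp A B (∑ i ∈ t, X i) = ∑ i ∈ t, dexp A B (X i) := by
  classical
  induction t using Finset.induction_on with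
  | empty => simp [dexp_zero]
  | insert i t hi ih => rw [Finset.sum_insert hi, Finset.sum_insert hi, dexp_add, ih]

/-- For `Y = 1` this is the difference of two exponentials, for `A = B` a commutator. -/
lemma dexp_commutator (A B Y : Mat) :
    dexp A B (A * Y - Y * B) = NormedSpace.exp A * Y - Y * NormedSpace.exp B := by
  refine (hasSum_dexp A B _).unique ?_
  simp only [powDeriv_commutator]
  have h1 := (hasSum_exp_succ A).mul_right Y
  have h2 := (hasSum_exp_succ B).mul_left Y
  have h3 := h1.sub h2
  rw [sub_mul, mul_sub, one_mul, mul_one, sub_sub_sub_cancel_right] at h3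
  refine hasSum_of_eq h3 fun n => ?_
  simp [smul_sub]

lemma dexp_self_sub (A B : Mat) : dexp A B (A - B) = NormedSpace.exp A - NormedSpace.exp B := by
  simpa using dexp_commutator A B 1

lemma dexp_of_commute {A X : Mat} (h : Commute A X) : dexp A A X = X * NormedSpace.exp A := by
  refine (hasSum_dexp A A _).unique ?_
  refine hasSum_of_eq ((hasSum_exp A).mul_left X) fun n => ?_
  rw [powDeriv_of_commute h, Nat.factorial_succ, ← Nat.cast_smul_eq_nsmul ℝ, smul_smul,
    mul_smul_comm]
  congr 1
  push_cast
  have : (n ! : ℝ) ≠ 0 := by positivity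
  field_simp

lemma commute_exp {A X : Mat} (h : Commute A X) : Commute (NormedSpace.exp A) X := by
  have := dexp_commutator A A X
  rw [h.eq, sub_self, dexp_zero] at this
  exact (sub_eq_zero.1 this.symm)

/-! ### Symmetric `2 × 2` matrices -/

/-- The symmetric matrix with mean `m` and traceless part `(γ, p; p, -γ)`. -/
abbrev symMat (m γ p : ℝ) : Mat := !![m + γ, p; p, m - γ]

/-- The exponential of a symmetric `2 × 2` matrix that is not a multiple of the identity, from its
spectral decomposition; the eigenvalues are `m ± ρ`. -/
lemma exp_symMat {m γ p ρ : ℝ} (hρ : ρ ≠ 0) (h : ρ ^ 2 = γ ^ 2 + p ^ 2) :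
    NormedSpace.exp (symMat m γ p) =
      symMat ((Real.exp (m + ρ) + Real.exp (m - ρ)) / 2)
        ((Real.exp (m + ρ) - Real.exp (m - ρ)) / (2 * ρ) * γ)
        ((Real.exp (m + ρ) - Real.exp (m - ρ)) / (2 * ρ) * p) := by
  -- the two matrices on the right are the spectral projections
  have hpow : ∀ n : ℕ, symMat m γ p ^ n =
      (m + ρ) ^ n • symMat (1 / 2) (γ / (2 * ρ)) (p / (2 * ρ)) +
      (m - ρ) ^ n • symMat (1 / 2) (-γ / (2 * ρ)) (-p / (2 * ρ)) := by
    intro n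
    induction n with
    | zero =>
      ext i j; fin_cases i <;> fin_cases j <;> simp <;> ring
    | succ n ih =>
      rw [pow_succ, ih]
      generalize hx : (m + ρ) ^ n = X
      generalize hy : (m - ρ) ^ n = Y
      rw [pow_succ, pow_succ, hx, hy]
      ext i j; fin_cases i <;> fin_cases j <;>
        simp [Matrix.mul_apply] <;> field_simp <;>
        first | linear_combination (Y - X) * h | linear_combination (X - Y) * h | ring
  have h1 := NormedSpace.expSeries_div_hasSum_exp (m + ρ)
  have h2 := NormedSpace.expSeries_div_hasSum_exp (m - ρ)
  rw [← Real.exp_eq_exp_ℝ] at h1 h2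
  have h3 := (h1.smul_const (symMat (1 / 2) (γ / (2 * ρ)) (p / (2 * ρ)))).add
    (h2.smul_const (symMat (1 / 2) (-γ / (2 * ρ)) (-p / (2 * ρ))))
  refine (hasSum_exp _).unique ?_
  have h4 : ∀ n : ℕ, (n ! : ℝ)⁻¹ • symMat m γ p ^ n = _ := fun n => by
    rw [hpow, smul_add, smul_smul, smul_smul, ← div_eq_inv_mul, ← div_eq_inv_mul]
  convert hasSum_of_eq h3 h4 using 1
  ext i j; fin_cases i <;> fin_cases j <;> simp <;> field_simp <;> ring

/-- The identity behind the log-conformation equation: the velocity gradient terms of the equation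
for `Ψ` are the preimage of `ε σ + σ ε` under the derivative of the exponential at `Ψ`. The part of
`ε` that commutes with `Ψ` is merely multiplied by `σ`; the remaining part is a multiple of
`rotMat Ψ = [Ψ, J] / 2` with `J` the rotation by a right angle, on which the derivative of the
exponential acts by a divided difference. -/
lemma dexp_strain {Ψ : Mat} (hΨ : Ψᵀ = Ψ) {ε : Mat} (hε : εᵀ = ε) :
    dexp Ψ Ψ ((2 : ℝ) • ε + (2 * (gam Ψ * ε 0 1 - Ψ 0 1 * gam ε) * f Ψ) • rotMat Ψ) =
      ε * NormedSpace.exp Ψ + NormedSpace.exp Ψ * ε := by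
  set m := (Ψ 0 0 + Ψ 1 1) / 2 with hm
  set γ := gam Ψ with hγ
  set p := Ψ 0 1 with hp
  have sym : ∀ M : Mat, Mᵀ = M → M = symMat ((M 0 0 + M 1 1) / 2) (gam M) (M 0 1) := by
    intro M hM
    have h10 : M 1 0 = M 0 1 := congrFun (congrFun hM 0) 1
    ext i j; fin_cases i <;> fin_cases j <;> simp [gam, h10] <;> ring
  have hΨe : Ψ = symMat m γ p := sym Ψ hΨ
  set ρ := Real.sqrt (γ ^ 2 + p ^ 2) with hρ
  have hsq : ρ ^ 2 = γ ^ 2 + p ^ 2 := Real.sq_sqrt (by positivity)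
  have hf : f Ψ = fScalar ρ := rfl
  rcases eq_or_ne ρ 0 with h0 | h0
  · have hγ0 : γ = 0 := by nlinarith [sq_nonneg γ, sq_nonneg p]
    have hp0 : p = 0 := by nlinarith [sq_nonneg γ, sq_nonneg p]
    have hc : Commute Ψ ε := by
      rw [hΨe, hγ0, hp0]
      have : symMat m 0 0 = m • (1 : Mat) := by
        ext i j; fin_cases i <;> fin_cases j <;> simp
      rw [this]
      exact (Commute.one_left ε).smul_left m
    rw [hγ0, hp0]
    simp only [zero_mul, sub_zero, mul_zero, zero_smul, add_zero]
    rw [dexp_smul, dexp_of_commute hc, (commute_exp hc).eq, two_smul]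
  -- `ε = α + c Ψ₀ + d rotMat Ψ` with `Ψ₀` the traceless part of `Ψ`
  · set α := (ε 0 0 + ε 1 1) / 2 with hα
    set c := (γ * gam ε + p * ε 0 1) / ρ ^ 2 with hc
    set d := (γ * ε 0 1 - p * gam ε) / ρ ^ 2 with hd
    have e1 : gam ε = c * γ - d * p := by
      rw [hc, hd]; field_simp; rw [hsq]; ring
    have e2 : ε 0 1 = c * p + d * γ := by
      rw [hc, hd]; field_simp; rw [hsq]; ring
    have e3 : γ * ε 0 1 - p * gam ε = d * ρ ^ 2 := by rw [hd]; field_simp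
    have hεe : ε = symMat α (c * γ - d * p) (c * p + d * γ) := by rw [← e1, ← e2]; exact sym ε hε
    have hexp := exp_symMat (m := m) h0 hsq
    rw [← hΨe] at hexp
    set S := (Real.exp (m + ρ) + Real.exp (m - ρ)) / 2 with hS
    set D := (Real.exp (m + ρ) - Real.exp (m - ρ)) / (2 * ρ) with hD
    -- the function `f` is designed so that the divided difference `D` of `exp` becomes the mean `S`
    have key : (1 + ρ ^ 2 * f Ψ) * D = S := by
      have hE : Real.exp (2 * ρ) - 1 ≠ 0 := by
        rw [sub_ne_zero, Ne, Real.exp_eq_one_iff]; simpa using h0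
      have hEm : Real.exp (m + ρ) = Real.exp (m - ρ) * Real.exp (2 * ρ) := by
        rw [← Real.exp_add]; congr 1; ring
      rw [hf, fScalar, if_neg h0, hS, hD, hEm]
      generalize Real.exp (2 * ρ) = E at hE
      field_simp
      ring
    -- `2 rotMat Ψ = Ψ J - J Ψ`
    let J : Mat := !![0, 1; -1, 0]
    have hX : (2 : ℝ) • ε + (2 * (γ * ε 0 1 - p * gam ε) * f Ψ) • rotMat Ψ =
        symMat (2 * α) (2 * c * γ) (2 * c * p) +
          (d * (1 + ρ ^ 2 * f Ψ)) • (Ψ * J - J * Ψ) := by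
      rw [e3]
      have hr : rotMat Ψ = !![-p, γ; γ, p] := rfl
      rw [hr, hεe, hΨe]
      ext i j; fin_cases i <;> fin_cases j <;> simp [J] <;> ring
    have hcomm : Commute Ψ (symMat (2 * α) (2 * c * γ) (2 * c * p)) := by
      have : symMat (2 * α) (2 * c * γ) (2 * c * p) =
          (2 * α - 2 * c * m) • (1 : Mat) + (2 * c) • Ψ := by
        rw [hΨe]
        ext i j; fin_cases i <;> fin_cases j <;> simp <;> ring
      rw [this]
      exact ((Commute.one_right Ψ).smul_right _).add_right ((Commute.refl Ψ).smul_right _)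
    rw [hX, dexp_add, dexp_of_commute hcomm, dexp_smul, dexp_commutator, hexp, hεe]
    have key2 : d * (1 + ρ ^ 2 * f Ψ) * D = d * S := by rw [mul_assoc, key]
    generalize d * (1 + ρ ^ 2 * f Ψ) = q at key2 ⊢
    clear_value S D α c d
    ext i j; fin_cases i <;> fin_cases j <;> simp [J]
    · linear_combination (-2 * p) * key2
    · linear_combination (2 * γ) * key2
    · linear_combination (2 * γ) * key2
    · linear_combination (2 * p) * key2

end MatrixExponential

/-! ### Sobolev norms of matrix fields -/

section MatrixFields

open scoped Nat

variable {r s : ℝ} {Ω : Set Plane} {X Y : Plane → Mat}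

/-- The norm of a matrix field in `H^r(Ω)`: the sum of the norms of the entries. -/
noncomputable def matNorm (r : ℝ) (Ω : Set Plane) (X : Plane → Mat) : ℝ≥0∞ :=
  ∑ i, ∑ j, hsNorm r Ω fun x => X x i j

lemma hsNorm_le_matNorm (i j : Fin 2) : hsNorm r Ω (fun x => X x i j) ≤ matNorm r Ω X :=
  (Finset.single_le_sum (f := fun j => hsNorm r Ω fun x => X x i j) (fun _ _ => zero_le)
    (Finset.mem_univ j)).trans
  (Finset.single_le_sum (f := fun i => ∑ j, hsNorm r Ω fun x => X x i j) (fun _ _ => zero_le)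
    (Finset.mem_univ i))

lemma matNorm_lt_top_iff : matNorm r Ω X < ⊤ ↔ ∀ i j, MemHs r Ω fun x => X x i j := by
  simp only [matNorm, memHs_iff, ENNReal.sum_lt_top, Finset.mem_univ, forall_true_left]

lemma tendsto_matNorm_iff {ι : Type*} {l : Filter ι} {F : ι → Plane → Mat} :
    Tendsto (fun t => matNorm r Ω (F t)) l (𝓝 0) ↔
      ∀ i j, Tendsto (fun t => hsNorm r Ω fun x => F t x i j) l (𝓝 0) := by
  refine ⟨fun h i j => tendsto_of_tendsto_of_tendsto_of_le_of_le tendsto_const_nhds h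
    (fun _ => zero_le) fun t => hsNorm_le_matNorm i j, fun h => ?_⟩
  have := tendsto_finsetSum (Finset.univ : Finset (Fin 2)) fun i _ =>
    tendsto_finsetSum (Finset.univ : Finset (Fin 2)) fun j _ => h i j
  simpa [matNorm] using this

lemma matNorm_zero : matNorm r Ω 0 = 0 := by
  have : ∀ i j, hsNorm r Ω (fun x => (0 : Plane → Mat) x i j) = 0 := fun i j => hsNorm_zero
  simp only [matNorm, this, Finset.sum_const_zero]

lemma matNorm_add_le (hr : 0 ≤ r) : matNorm r Ω (X + Y) ≤ matNorm r Ω X + matNorm r Ω Y := by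
  simp only [matNorm, ← Finset.sum_add_distrib]
  exact Finset.sum_le_sum fun i _ => Finset.sum_le_sum fun j _ => hsNorm_add_le hr

lemma matNorm_smul_le (c : ℝ) : matNorm r Ω (c • X) ≤ ‖c‖ₑ * matNorm r Ω X := by
  simp only [matNorm, Finset.mul_sum]
  exact Finset.sum_le_sum fun i _ => Finset.sum_le_sum fun j _ => hsNorm_smul_le c

lemma matNorm_le_tsum (hr : 0 ≤ r) {F : ℕ → Plane → Mat}
    (h : ∀ x, HasSum (fun n => F n x) (X x)) : matNorm r Ω X ≤ ∑' n, matNorm r Ω (F n) := by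
  simp only [matNorm]
  rw [Summable.tsum_finsetSum fun _ _ => ENNReal.summable]
  refine Finset.sum_le_sum fun i _ => ?_
  rw [Summable.tsum_finsetSum fun _ _ => ENNReal.summable]
  refine Finset.sum_le_sum fun j _ => hsNorm_le_tsum hr (Eventually.of_forall fun x => ?_)
  exact Pi.hasSum.1 (Pi.hasSum.1 (h x) i) j

/-- `C` bounds the products `H^s(Ω) × H^r(Ω) → H^r(Ω)` and `H^r(Ω) × H^s(Ω) → H^r(Ω)` of matrix
fields. -/
structure MulBound (C : ℝ≥0) (r s : ℝ) (Ω : Set Plane) : Prop where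
  left : ∀ X Y, matNorm r Ω (X * Y) ≤ C * (matNorm s Ω X * matNorm r Ω Y)
  right : ∀ X Y, matNorm r Ω (X * Y) ≤ C * (matNorm r Ω X * matNorm s Ω Y)

lemma matNorm_mul_le_of {C : ℝ≥0} {r₁ r₂ : ℝ} (hr : 0 ≤ r)
    (h : ∀ v w : Plane → ℝ, hsNorm r Ω (fun x => v x * w x) ≤
      C * (hsNorm r₁ Ω v * hsNorm r₂ Ω w)) (X Y : Plane → Mat) :
    matNorm r Ω (X * Y) ≤ C * (matNorm r₁ Ω X * matNorm r₂ Ω Y) := by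
  have entry : ∀ i j, hsNorm r Ω (fun x => (X * Y) x i j) ≤
      ∑ l, C * (hsNorm r₁ Ω (fun x => X x i l) * hsNorm r₂ Ω fun x => Y x l j) := by
    intro i j
    have e : (fun x => (X * Y) x i j) = fun x => X x i 0 * Y x 0 j + X x i 1 * Y x 1 j := by
      ext x
      simp [Matrix.mul_apply]
    rw [e, Fin.sum_univ_two]
    exact (hsNorm_add_le hr).trans (add_le_add (h _ _) (h _ _))
  calc matNorm r Ω (X * Y) ≤ ∑ i, ∑ j, ∑ l, C * (hsNorm r₁ Ω (fun x => X x i l) *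
        hsNorm r₂ Ω fun x => Y x l j) :=
        Finset.sum_le_sum fun i _ => Finset.sum_le_sum fun j _ => entry i j
    _ = C * ∑ i, ∑ l, hsNorm r₁ Ω (fun x => X x i l) * ∑ j, hsNorm r₂ Ω fun x => Y x l j := by
        simp only [Finset.mul_sum]
        exact Finset.sum_congr rfl fun i _ => Finset.sum_comm
    _ ≤ C * ∑ i, ∑ l, hsNorm r₁ Ω (fun x => X x i l) * matNorm r₂ Ω Y := by
        gcongr with i _ l _
        exact Finset.single_le_sum (f := fun l => ∑ j, hsNorm r₂ Ω fun x => Y x l j)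
          (fun _ _ => zero_le) (Finset.mem_univ l)
    _ = _ := by simp only [matNorm, Finset.sum_mul]

lemma exists_mulBound (hs : 1 < s) (hr : 0 ≤ r) (hrs : r ≤ s) :
    ∃ C : ℝ≥0, ∀ Ω, MulBound C r s Ω := by
  obtain ⟨C, hC⟩ := exists_hsNorm_mul_le hs hr hrs
  refine ⟨C, fun Ω => ⟨fun X Y => matNorm_mul_le_of hr (hC Ω) X Y,
    fun X Y => matNorm_mul_le_of hr (fun v w => ?_) X Y⟩⟩
  rw [mul_comm (hsNorm r Ω v)]
  simpa only [mul_comm (v _)] using hC Ω w v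

section Estimates

variable {C m : ℝ≥0} {A B A' B' : Plane → Mat}

lemma matNorm_pow_mul_le (hN : MulBound C r s Ω) (hA : matNorm s Ω A ≤ m) (n : ℕ) :
    matNorm r Ω (A ^ n * X) ≤ ((C * m : ℝ≥0) : ℝ≥0∞) ^ n * matNorm r Ω X := by
  induction n with
  | zero => simp
  | succ n ih =>
    rw [pow_succ', mul_assoc]
    calc _ ≤ C * (matNorm s Ω A * matNorm r Ω (A ^ n * X)) := hN.left _ _
      _ ≤ C * (m * (((C * m : ℝ≥0) : ℝ≥0∞) ^ n * matNorm r Ω X)) := by gcongr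
      _ = _ := by push_cast; ring

lemma matNorm_pow_sub_mul_le (hr : 0 ≤ r) (hN : MulBound C r s Ω) (hm : 1 ≤ m)
    (hA : matNorm s Ω A ≤ m) (hA' : matNorm s Ω A' ≤ m) (n : ℕ) :
    matNorm r Ω ((A ^ n - A' ^ n) * X) ≤
      n * ((C * m : ℝ≥0) : ℝ≥0∞) ^ n * (matNorm s Ω (A - A') * matNorm r Ω X) := by
  induction n with
  | zero => simp [matNorm_zero]
  | succ n ih =>
    have e : (A ^ (n + 1) - A' ^ (n + 1)) * X =
        A * ((A ^ n - A' ^ n) * X) + (A - A') * (A' ^ n * X) := by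
      rw [pow_succ', pow_succ']; noncomm_ring
    rw [e]
    set q : ℝ≥0∞ := ((C * m : ℝ≥0) : ℝ≥0∞) with hq
    have hCq : (C : ℝ≥0∞) ≤ q := by rw [hq]; exact_mod_cast le_mul_of_one_le_right' hm
    calc _ ≤ C * (matNorm s Ω A * matNorm r Ω ((A ^ n - A' ^ n) * X)) +
          C * (matNorm s Ω (A - A') * matNorm r Ω (A' ^ n * X)) :=
          (matNorm_add_le hr).trans (add_le_add (hN.left _ _) (hN.left _ _))
      _ ≤ C * (m * (n * q ^ n * (matNorm s Ω (A - A') * matNorm r Ω X))) +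
          q * (matNorm s Ω (A - A') * (q ^ n * matNorm r Ω X)) := by
          gcongr
          exact matNorm_pow_mul_le hN hA' n
      _ = _ := by rw [hq]; push_cast; ring

lemma matNorm_powDeriv_le (hr : 0 ≤ r) (hN : MulBound C r s Ω)
    (hA : matNorm s Ω A ≤ m) (hB : matNorm s Ω B ≤ m) (n : ℕ) :
    matNorm r Ω (powDeriv A B X n) ≤
      (n + 1) * ((C * m : ℝ≥0) : ℝ≥0∞) ^ n * matNorm r Ω X := by
  induction n with
  | zero => simp [powDeriv]
  | succ n ih =>
    rw [powDeriv_succ]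
    set q : ℝ≥0∞ := ((C * m : ℝ≥0) : ℝ≥0∞) with hq
    calc _ ≤ C * (matNorm r Ω (powDeriv A B X n) * matNorm s Ω B) +
          q ^ (n + 1) * matNorm r Ω X :=
          (matNorm_add_le hr).trans (add_le_add (hN.right _ _) (matNorm_pow_mul_le hN hA _))
      _ ≤ C * (((n + 1) * q ^ n * matNorm r Ω X) * m) + q ^ (n + 1) * matNorm r Ω X := by gcongr
      _ = _ := by rw [hq]; push_cast; ring

/-- The Lipschitz bound behind the continuity of `dexp A B` in `A` and `B`. -/
lemma matNorm_powDeriv_sub_le (hr : 0 ≤ r) (hN : MulBound C r s Ω) (hm : 1 ≤ m)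
    (hA : matNorm s Ω A ≤ m) (hB : matNorm s Ω B ≤ m) (hA' : matNorm s Ω A' ≤ m)
    (hB' : matNorm s Ω B' ≤ m) (n : ℕ) :
    matNorm r Ω (powDeriv A B X n - powDeriv A' B' X n) ≤
      n * (n + 1) * ((C * m : ℝ≥0) : ℝ≥0∞) ^ n *
        ((matNorm s Ω (A - A') + matNorm s Ω (B - B')) * matNorm r Ω X) := by
  induction n with
  | zero => simp [powDeriv, matNorm_zero]
  | succ n ih =>
    have e : powDeriv A B X (n + 1) - powDeriv A' B' X (n + 1) =
        (powDeriv A B X n - powDeriv A' B' X n) * B + powDeriv A' B' X n * (B - B') +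
          (A ^ (n + 1) - A' ^ (n + 1)) * X := by
      rw [powDeriv_succ, powDeriv_succ]; noncomm_ring
    rw [e]
    set q : ℝ≥0∞ := ((C * m : ℝ≥0) : ℝ≥0∞) with hq
    set a := matNorm s Ω (A - A')
    set b := matNorm s Ω (B - B')
    set x := matNorm r Ω X
    have hCq : (C : ℝ≥0∞) ≤ q := by rw [hq]; exact_mod_cast le_mul_of_one_le_right' hm
    calc _ ≤ C * (matNorm r Ω (powDeriv A B X n - powDeriv A' B' X n) * matNorm s Ω B) +
          C * (matNorm r Ω (powDeriv A' B' X n) * b) +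
            ((n + 1 : ℕ) * q ^ (n + 1) * (a * x)) :=
          (matNorm_add_le hr).trans (add_le_add ((matNorm_add_le hr).trans
            (add_le_add (hN.right _ _) (hN.right _ _)))
            (matNorm_pow_sub_mul_le hr hN hm hA hA' _))
      _ ≤ C * ((n * (n + 1) * q ^ n * ((a + b) * x)) * m) + q * (((n + 1) * q ^ n * x) * b) +
            ((n + 1 : ℕ) * q ^ (n + 1) * (a * x)) := by
          gcongr
          exact matNorm_powDeriv_le hr hN hA' hB' n
      _ = (n + 1) * (n + 1) * q ^ (n + 1) * ((a + b) * x) := by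
          rw [hq]; push_cast; ring
      _ ≤ _ := by
          push_cast
          gcongr
          norm_num

/-- The bound `exp (2 q)` for the series of `dexp` and of its differences. -/
noncomputable def expBound (q : ℝ≥0) : ℝ≥0∞ := ∑' n : ℕ, (((2 * q) ^ n / n ! : ℝ≥0) : ℝ≥0∞)

lemma expBound_ne_top (q : ℝ≥0) : expBound q ≠ ⊤ := by
  rw [expBound, ENNReal.tsum_coe_ne_top_iff_summable, ← NNReal.summable_coe]
  simpa using Real.summable_pow_div_factorial ((2 * q : ℝ≥0) : ℝ)

/-- The factors `n + 1` and `n (n + 1)` are polynomial in `n`, hence at most a power of a constant,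
which the factorial compensates. -/
lemma coeff_mul_le {c : ℝ≥0∞} (q : ℝ≥0) (n : ℕ) (hc : c ≤ 2 ^ n * (n + 1)) :
    ‖((n + 1)! : ℝ)⁻¹‖ₑ * (c * (q : ℝ≥0∞) ^ n) ≤ (((2 * q) ^ n / n ! : ℝ≥0) : ℝ≥0∞) := by
  have e : ‖((n + 1)! : ℝ)⁻¹‖ₑ = ((((n + 1)! : ℝ≥0)⁻¹ : ℝ≥0) : ℝ≥0∞) := by
    rw [enorm_eq_nnnorm]; simp
  rw [e]
  calc _ ≤ ((((n + 1)! : ℝ≥0)⁻¹ : ℝ≥0) : ℝ≥0∞) * ((2 ^ n * (n + 1)) * (q : ℝ≥0∞) ^ n) := by gcongr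
    _ = ((((n + 1)! : ℝ≥0)⁻¹ * ((2 ^ n * (n + 1)) * q ^ n) : ℝ≥0) : ℝ≥0∞) := by push_cast; rfl
    _ ≤ _ := by
      rw [ENNReal.coe_le_coe, Nat.factorial_succ]
      apply le_of_eq
      push_cast
      have h1 : (n ! : ℝ≥0) ≠ 0 := by positivity
      field_simp
      rw [mul_pow]

lemma matNorm_dexpTerm_le (hr : 0 ≤ r) (hN : MulBound C r s Ω) (hA : matNorm s Ω A ≤ m)
    (hB : matNorm s Ω B ≤ m) (n : ℕ) :
    matNorm r Ω (((n + 1)! : ℝ)⁻¹ • powDeriv A B X n) ≤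
      (((2 * (C * m)) ^ n / n ! : ℝ≥0) : ℝ≥0∞) * matNorm r Ω X := by
  refine (matNorm_smul_le _).trans ?_
  refine (mul_le_mul_right (matNorm_powDeriv_le hr hN hA hB n) _).trans ?_
  rw [← mul_assoc]
  gcongr
  refine coeff_mul_le _ _ ?_
  calc ((n : ℝ≥0∞) + 1) = 1 * (n + 1) := by rw [one_mul]
    _ ≤ _ := by gcongr; exact one_le_pow₀ (by norm_num)

/-- `dexp` applied pointwise to matrix fields. -/
noncomputable def dexpField (A B X : Plane → Mat) : Plane → Mat :=
  fun x => dexp (A x) (B x) (X x)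

lemma hasSum_dexpField (A B X : Plane → Mat) (x : Plane) :
    HasSum (fun n : ℕ => (((n + 1)! : ℝ)⁻¹ • powDeriv A B X n) x) (dexpField A B X x) := by
  simp only [Pi.smul_apply, powDeriv_apply]
  exact hasSum_dexp (A x) (B x) (X x)

lemma matNorm_dexpField_le (hr : 0 ≤ r) (hN : MulBound C r s Ω) (hA : matNorm s Ω A ≤ m)
    (hB : matNorm s Ω B ≤ m) :
    matNorm r Ω (dexpField A B X) ≤ expBound (C * m) * matNorm r Ω X := by
  refine (matNorm_le_tsum hr (hasSum_dexpField A B X)).trans ?_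
  rw [expBound, ← ENNReal.tsum_mul_right]
  exact ENNReal.tsum_le_tsum fun n => matNorm_dexpTerm_le hr hN hA hB n

lemma matNorm_dexpField_sub_le (hr : 0 ≤ r) (hN : MulBound C r s Ω) (hm : 1 ≤ m)
    (hA : matNorm s Ω A ≤ m) (hB : matNorm s Ω B ≤ m) (hA' : matNorm s Ω A' ≤ m)
    (hB' : matNorm s Ω B' ≤ m) :
    matNorm r Ω (dexpField A B X - dexpField A' B' X) ≤ expBound (C * m) *
      ((matNorm s Ω (A - A') + matNorm s Ω (B - B')) * matNorm r Ω X) := by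
  have hsum : ∀ x, HasSum (fun n : ℕ => (((n + 1)! : ℝ)⁻¹ •
      (powDeriv A B X n - powDeriv A' B' X n)) x) ((dexpField A B X - dexpField A' B' X) x) := by
    intro x
    simpa only [Pi.smul_apply, Pi.sub_apply, smul_sub] using
      (hasSum_dexpField A B X x).sub (hasSum_dexpField A' B' X x)
  refine (matNorm_le_tsum hr hsum).trans ?_
  rw [expBound, ← ENNReal.tsum_mul_right]
  refine ENNReal.tsum_le_tsum fun n => ?_
  refine (matNorm_smul_le _).trans ?_
  refine (mul_le_mul_right (matNorm_powDeriv_sub_le hr hN hm hA hB hA' hB' n) _).trans ?_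
  rw [← mul_assoc]
  gcongr
  refine coeff_mul_le _ _ ?_
  gcongr
  exact_mod_cast Nat.lt_two_pow_self.le

end Estimates

end MatrixFields

/-! ### Chain rules for the exponential of a field -/

section ChainRules

open scoped Nat

variable {r s T : ℝ} {Ω : Set Plane} {k : Fin 2}

/-- `X ∈ C⁰([0,T], H^r(Ω))` for a matrix field `X`, in terms of `matNorm`. -/
def MatC0 (r T : ℝ) (Ω : Set Plane) (X : ℝ → Plane → Mat) : Prop :=
  (∀ t ∈ Icc 0 T, matNorm r Ω (X t) < ⊤) ∧
    ∀ t₀ ∈ Icc 0 T, Tendsto (fun t => matNorm r Ω (X t - X t₀)) (𝓝[Icc 0 T] t₀) (𝓝 0)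

lemma matC0_iff {X : ℝ → Plane → Mat} :
    MatC0 r T Ω X ↔ ∀ i j, MemC0Hs r T Ω fun t x => X t x i j := by
  simp only [MatC0, matNorm_lt_top_iff, tendsto_matNorm_iff, MemC0Hs]
  exact ⟨fun h i j => ⟨fun t ht => h.1 t ht i j, fun t ht => h.2 t ht i j⟩,
    fun h => ⟨fun t ht i j => (h i j).1 t ht, fun t ht i j => (h i j).2 t ht⟩⟩

lemma isTimeDerivative_iff {X X' : ℝ → Plane → Mat} :
    IsTimeDerivative s T Ω X X' ↔ MatC0 (s - 1) T Ω X' ∧ ∀ t₀ ∈ Icc 0 T,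
      Tendsto (fun t => matNorm (s - 1) Ω ((t - t₀)⁻¹ • (X t - X t₀) - X' t₀))
        (𝓝[Icc 0 T \ {t₀}] t₀) (𝓝 0) := by
  simp only [matC0_iff, tendsto_matNorm_iff, IsTimeDerivative, HasTimeDeriv]
  exact ⟨fun h => ⟨fun i j => (h i j).1, fun t ht i j => (h i j).2 t ht⟩,
    fun h i j => ⟨h.1 i j, fun t ht => h.2 t ht i j⟩⟩

/-- The exponential of a matrix field. -/
noncomputable def expField (A : Plane → Mat) : Plane → Mat := fun x => NormedSpace.exp (A x)

lemma dexpField_self_sub (A B : Plane → Mat) :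
    dexpField A B (A - B) = expField A - expField B :=
  funext fun x => dexp_self_sub (A x) (B x)

lemma expField_eq_one_add (A : Plane → Mat) : expField A = 1 + dexpField A 0 A := by
  have h1 := dexpField_self_sub A 0
  have h0 : expField 0 = 1 := funext fun x => NormedSpace.exp_zero
  rw [sub_zero, h0] at h1
  rw [h1, add_sub_cancel]

lemma dexpField_sub (A B X Y : Plane → Mat) :
    dexpField A B (X - Y) = dexpField A B X - dexpField A B Y :=
  funext fun x => dexp_sub (A x) (B x) (X x) (Y x)

lemma dexpField_smul (A B X : Plane → Mat) (c : ℝ) :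
    dexpField A B (c • X) = c • dexpField A B X :=
  funext fun x => dexp_smul (A x) (B x) (X x) c

/-- A continuous field is locally bounded in time. -/
lemma MatC0.eventually_le {X : ℝ → Plane → Mat} (hr : 0 ≤ r) (h : MatC0 r T Ω X) {t₀ : ℝ}
    (ht₀ : t₀ ∈ Icc 0 T) :
    ∃ m : ℝ≥0, 1 ≤ m ∧ matNorm r Ω (X t₀) ≤ m ∧
      ∀ᶠ t in 𝓝[Icc 0 T] t₀, matNorm r Ω (X t) ≤ m := by
  have h1 := h.1 t₀ ht₀
  refine ⟨(matNorm r Ω (X t₀)).toNNReal + 1, le_add_self, ?_, ?_⟩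
  · push_cast
    rw [ENNReal.coe_toNNReal h1.ne]
    exact le_self_add
  · filter_upwards [(h.2 t₀ ht₀).eventually_lt_const (zero_lt_one)] with t ht
    push_cast
    rw [ENNReal.coe_toNNReal h1.ne]
    calc matNorm r Ω (X t) = matNorm r Ω (X t₀ + (X t - X t₀)) := by rw [add_sub_cancel]
      _ ≤ _ := matNorm_add_le hr
      _ ≤ _ := by gcongr

lemma matNorm_one_lt_top (hb : Bornology.IsBounded Ω) (hm : MeasurableSet Ω) :
    matNorm s Ω 1 < ⊤ :=
  matNorm_lt_top_iff.2 fun i j =>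
    (hasSobolevPartial_const (k := 0) hb hm ((1 : Mat) i j)).memHs

/-- The exponential preserves `C⁰([0,T], H^s(Ω))`. -/
lemma MatC0.exp (hb : Bornology.IsBounded Ω) (hm : MeasurableSet Ω) (hs : 1 < s)
    {Ψ : ℝ → Plane → Mat} (h : MatC0 s T Ω Ψ) : MatC0 s T Ω fun t => expField (Ψ t) := by
  have hs0 : 0 ≤ s := by linarith
  obtain ⟨C, hC⟩ := exists_mulBound hs hs0 le_rfl
  refine ⟨fun t ht => ?_, fun t₀ ht₀ => ?_⟩
  · have e := expField_eq_one_add (Ψ t)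
    obtain ⟨m, -, hm1, -⟩ := h.eventually_le hs0 ht
    change matNorm s Ω (expField (Ψ t)) < ⊤
    rw [e]
    refine (matNorm_add_le hs0).trans_lt (ENNReal.add_lt_top.2 ⟨matNorm_one_lt_top hb hm, ?_⟩)
    refine (matNorm_dexpField_le hs0 (hC Ω) hm1 (by rw [matNorm_zero]; exact zero_le)).trans_lt ?_
    exact ENNReal.mul_lt_top (expBound_ne_top _).lt_top (h.1 t ht)
  · obtain ⟨m, -, hm1, hm2⟩ := h.eventually_le hs0 ht₀
    have t1 := ENNReal.Tendsto.const_mul (a := expBound (C * m)) (h.2 t₀ ht₀)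
      (by right; exact expBound_ne_top _)
    rw [mul_zero] at t1
    refine tendsto_of_tendsto_of_tendsto_of_le_of_le' tendsto_const_nhds t1
      (Eventually.of_forall fun _ => zero_le) ?_
    filter_upwards [hm2] with t ht
    rw [← dexpField_self_sub]
    exact matNorm_dexpField_le hs0 (hC Ω) ht hm1

/-- The chain rule in time: `∂ₜ exp Ψ = dexp_Ψ (∂ₜ Ψ)` in `C⁰([0,T], H^{s-1}(Ω))`. -/
lemma isTimeDerivative_exp (hs : 1 < s) {Ψ Ψ' : ℝ → Plane → Mat} (h : MatC0 s T Ω Ψ)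
    (h' : IsTimeDerivative s T Ω Ψ Ψ') :
    IsTimeDerivative s T Ω (fun t => expField (Ψ t)) fun t => dexpField (Ψ t) (Ψ t) (Ψ' t) := by
  have hs0 : 0 ≤ s := by linarith
  have hr0 : 0 ≤ s - 1 := by linarith
  obtain ⟨C, hC⟩ := exists_mulBound (r := s - 1) hs hr0 (by linarith)
  rw [isTimeDerivative_iff] at h' ⊢
  obtain ⟨c', d'⟩ := h'
  refine ⟨⟨fun t ht => ?_, fun t₀ ht₀ => ?_⟩, fun t₀ ht₀ => ?_⟩
  · obtain ⟨m, -, hm1, -⟩ := h.eventually_le hs0 ht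
    exact (matNorm_dexpField_le hr0 (hC Ω) hm1 hm1).trans_lt
      (ENNReal.mul_lt_top (expBound_ne_top _).lt_top (c'.1 t ht))
  · obtain ⟨m, hm0, hm1, hm2⟩ := h.eventually_le hs0 ht₀
    have t1 := ENNReal.Tendsto.const_mul (a := expBound (C * m)) (c'.2 t₀ ht₀)
      (by right; exact expBound_ne_top _)
    have t2 := ENNReal.Tendsto.const_mul (a := expBound (C * m))
      (ENNReal.Tendsto.mul_const ((h.2 t₀ ht₀).add (h.2 t₀ ht₀))
        (b := matNorm (s - 1) Ω (Ψ' t₀)) (by right; exact (c'.1 t₀ ht₀).ne))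
      (by right; exact expBound_ne_top _)
    have t3 := t1.add t2
    simp only [mul_zero, zero_mul, add_zero] at t3
    refine tendsto_of_tendsto_of_tendsto_of_le_of_le' tendsto_const_nhds t3
      (Eventually.of_forall fun _ => zero_le) ?_
    filter_upwards [hm2] with t ht
    have e : dexpField (Ψ t) (Ψ t) (Ψ' t) - dexpField (Ψ t₀) (Ψ t₀) (Ψ' t₀) =
        dexpField (Ψ t) (Ψ t) (Ψ' t - Ψ' t₀) +
          (dexpField (Ψ t) (Ψ t) (Ψ' t₀) - dexpField (Ψ t₀) (Ψ t₀) (Ψ' t₀)) := by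
      rw [dexpField_sub, sub_add_sub_cancel]
    rw [e]
    exact (matNorm_add_le hr0).trans (add_le_add (matNorm_dexpField_le hr0 (hC Ω) ht ht)
      (matNorm_dexpField_sub_le hr0 (hC Ω) hm0 ht ht hm1 hm1))
  · obtain ⟨m, hm0, hm1, hm2⟩ := h.eventually_le hs0 ht₀
    have hle : 𝓝[Icc 0 T \ {t₀}] t₀ ≤ 𝓝[Icc 0 T] t₀ := nhdsWithin_mono _ sdiff_subset
    have t1 := ENNReal.Tendsto.const_mul (a := expBound (C * m)) (d' t₀ ht₀)
      (by right; exact expBound_ne_top _)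
    have t2 := ENNReal.Tendsto.const_mul (a := expBound (C * m))
      (ENNReal.Tendsto.mul_const ((h.2 t₀ ht₀).mono_left hle)
        (b := matNorm (s - 1) Ω (Ψ' t₀)) (by right; exact (c'.1 t₀ ht₀).ne))
      (by right; exact expBound_ne_top _)
    have t3 := t1.add t2
    simp only [mul_zero, zero_mul, add_zero] at t3
    refine tendsto_of_tendsto_of_tendsto_of_le_of_le' tendsto_const_nhds t3
      (Eventually.of_forall fun _ => zero_le) ?_
    filter_upwards [hle hm2] with t ht
    -- the difference quotient is the polarized derivative of that of `Ψ`
    have e : (t - t₀)⁻¹ • (expField (Ψ t) - expField (Ψ t₀)) - dexpField (Ψ t₀) (Ψ t₀) (Ψ' t₀) =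
        dexpField (Ψ t) (Ψ t₀) ((t - t₀)⁻¹ • (Ψ t - Ψ t₀) - Ψ' t₀) +
          (dexpField (Ψ t) (Ψ t₀) (Ψ' t₀) - dexpField (Ψ t₀) (Ψ t₀) (Ψ' t₀)) := by
      rw [dexpField_sub, sub_add_sub_cancel, dexpField_smul, dexpField_self_sub]
    rw [e]
    refine (matNorm_add_le hr0).trans (add_le_add (matNorm_dexpField_le hr0 (hC Ω) ht hm1)
      ((matNorm_dexpField_sub_le hr0 (hC Ω) hm0 ht hm1 hm1 hm1).trans ?_))
    rw [sub_self (Ψ t₀), matNorm_zero, add_zero]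

/-- Entrywise `HasSobolevPartial` for matrix fields. -/
def MatPartial (s : ℝ) (Ω : Set Plane) (k : Fin 2) (X DX : Plane → Mat) : Prop :=
  ∀ i j, HasSobolevPartial s Ω k (fun x => X x i j) fun x => DX x i j

variable {X DX Y DY : Plane → Mat}

lemma MatPartial.add (h : MatPartial s Ω k X DX) (h' : MatPartial s Ω k Y DY) :
    MatPartial s Ω k (X + Y) (DX + DY) := fun i j => (h i j).add (h' i j)

lemma MatPartial.mul (hs : 1 < s) (h : MatPartial s Ω k X DX) (h' : MatPartial s Ω k Y DY) :
    MatPartial s Ω k (X * Y) (DX * Y + X * DY) := by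
  intro i j
  have := ((h i 0).mul hs (h' 0 j)).add ((h i 1).mul hs (h' 1 j))
  convert this using 1
  · ext x; simp [Matrix.mul_apply]
  · ext x; simp [Matrix.mul_apply]; ring

lemma matPartial_one (hb : Bornology.IsBounded Ω) (hm : MeasurableSet Ω) :
    MatPartial s Ω k 1 0 := fun i j => hasSobolevPartial_const hb hm ((1 : Mat) i j)

lemma MatPartial.smul (hb : Bornology.IsBounded Ω) (hm : MeasurableSet Ω) (hs : 1 < s)
    (h : MatPartial s Ω k X DX) (c : ℝ) : MatPartial s Ω k (c • X) (c • DX) := by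
  intro i j
  have := (hasSobolevPartial_const (s := s) (k := k) hb hm c).mul hs (h i j)
  simp only [zero_mul, zero_add] at this
  exact this

/-- The derivative of `X ^ (n + 1)` by the product rule. -/
lemma MatPartial.pow (hs : 1 < s) (h : MatPartial s Ω k X DX) (n : ℕ) :
    MatPartial s Ω k (X ^ (n + 1)) (powDeriv X X DX n) := by
  induction n with
  | zero => simpa [powDeriv] using h
  | succ n ih => rw [pow_succ X (n + 1), powDeriv_succ]; exact ih.mul hs h

lemma MatPartial.expSum (hb : Bornology.IsBounded Ω) (hm : MeasurableSet Ω) (hs : 1 < s)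
    (h : MatPartial s Ω k X DX) (N : ℕ) :
    MatPartial s Ω k (1 + ∑ n ∈ Finset.range N, ((n + 1)! : ℝ)⁻¹ • X ^ (n + 1))
      (∑ n ∈ Finset.range N, ((n + 1)! : ℝ)⁻¹ • powDeriv X X DX n) := by
  induction N with
  | zero => simpa using matPartial_one hb hm
  | succ N ih =>
    rw [Finset.sum_range_succ, Finset.sum_range_succ, ← add_assoc]
    exact ih.add ((h.pow hs N).smul hb hm hs _)

/-- The partial sums of the series of `dexp` converge in `H^r(Ω)`. -/
lemma tendsto_matNorm_dexpField_sub_sum (hr : 0 ≤ r) {C m : ℝ≥0} (hN : MulBound C r s Ω)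
    {A B : Plane → Mat} (hA : matNorm s Ω A ≤ m) (hB : matNorm s Ω B ≤ m)
    (hX : matNorm r Ω X < ⊤) :
    Tendsto (fun N => matNorm r Ω (dexpField A B X -
      ∑ n ∈ Finset.range N, ((n + 1)! : ℝ)⁻¹ • powDeriv A B X n)) atTop (𝓝 0) := by
  have hfin : ∑' n, matNorm r Ω (((n + 1)! : ℝ)⁻¹ • powDeriv A B X n) ≠ ⊤ := by
    refine ne_top_of_le_ne_top ?_ (ENNReal.tsum_le_tsum fun n =>
      matNorm_dexpTerm_le hr hN hA hB n)
    rw [ENNReal.tsum_mul_right]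
    exact (ENNReal.mul_lt_top (expBound_ne_top _).lt_top hX).ne
  refine tendsto_of_tendsto_of_tendsto_of_le_of_le tendsto_const_nhds
    (ENNReal.tendsto_sum_nat_add _ hfin) (fun _ => zero_le) fun N => ?_
  refine matNorm_le_tsum hr fun x => ?_
  have := (hasSum_nat_add_iff' N).2 (hasSum_dexpField A B X x)
  simpa using this

/-- The chain rule in space: `∂ₖ exp Ψ = dexp_Ψ (∂ₖ Ψ)` in the weak sense. -/
lemma MatPartial.exp (hb : Bornology.IsBounded Ω) (hm : MeasurableSet Ω) (hs : 1 < s)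
    (h : MatPartial s Ω k X DX) (i j : Fin 2) :
    HasWeakPartial Ω k (fun x => expField X x i j) fun x => dexpField X X DX x i j := by
  have hs0 : 0 ≤ s := by linarith
  obtain ⟨C, hC⟩ := exists_mulBound hs le_rfl hs0
  have hX : matNorm s Ω X < ⊤ := matNorm_lt_top_iff.2 fun i j => (h i j).memHs
  have hX0 : matNorm 0 Ω X < ⊤ := matNorm_lt_top_iff.2 fun i j =>
    memHs_iff.2 ((hsNorm_mono le_rfl hs0).trans_lt (memHs_iff.1 (h i j).memHs))
  have hDX : matNorm 0 Ω DX < ⊤ := matNorm_lt_top_iff.2 fun i j => (h i j).memHs_zero_right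
  have hle : matNorm s Ω X ≤ (matNorm s Ω X).toNNReal := by rw [ENNReal.coe_toNNReal hX.ne]
  have h0 : matNorm s Ω 0 ≤ (matNorm s Ω X).toNNReal := by rw [matNorm_zero]; exact zero_le
  -- the series of `exp X - 1` is that of `dexp X 0 X`
  have eX : ∀ n, powDeriv X 0 X n = X ^ (n + 1) := fun n => by
    have := powDeriv_commutator X 0 1 n
    simpa using this
  have eexp := expField_eq_one_add X
  obtain ⟨S, hSdef⟩ : ∃ S : ℕ → Plane → Mat, ∀ N, S N = 1 + ∑ n ∈ Finset.range N,
    ((n + 1)! : ℝ)⁻¹ • X ^ (n + 1) := ⟨_, fun _ => rfl⟩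
  obtain ⟨DS, hDSdef⟩ : ∃ DS : ℕ → Plane → Mat, ∀ N, DS N = ∑ n ∈ Finset.range N,
    ((n + 1)! : ℝ)⁻¹ • powDeriv X X DX n := ⟨_, fun _ => rfl⟩
  have hS : ∀ N, MatPartial s Ω k (S N) (DS N) := fun N => by
    rw [hSdef, hDSdef]; exact h.expSum hb hm hs N
  have t1 := tendsto_matNorm_dexpField_sub_sum le_rfl (hC Ω) hle h0 hX0
  have t2 := tendsto_matNorm_dexpField_sub_sum le_rfl (hC Ω) hle hle hDX
  simp only [eX] at t1
  simp only [← hDSdef] at t2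
  have e3 : ∀ N, dexpField X 0 X - ∑ n ∈ Finset.range N, ((n + 1)! : ℝ)⁻¹ • X ^ (n + 1) =
      expField X - S N := fun N => by rw [eexp, hSdef]; abel
  simp only [e3] at t1
  have conv : ∀ (F : Plane → Mat) (G : ℕ → Plane → Mat),
      Tendsto (fun N => matNorm 0 Ω (F - G N)) atTop (𝓝 0) →
      Tendsto (fun N => eLpNorm ((fun x => G N x i j) - fun x => F x i j) 2 (volume.restrict Ω))
        atTop (𝓝 0) := by
    intro F G hFG
    refine tendsto_of_tendsto_of_tendsto_of_le_of_le tendsto_const_nhds hFG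
      (fun _ => zero_le) fun N => ?_
    rw [eLpNorm_sub_comm]
    exact (eLpNorm_le_hsNorm (v := fun x => (F - G N) x i j) le_rfl).trans
      (hsNorm_le_matNorm (X := F - G N) i j)
  have memLp : ∀ {F : Plane → Mat}, matNorm 0 Ω F < ⊤ →
      MemLp (fun x => F x i j) 2 (volume.restrict Ω) := fun hF =>
    (matNorm_lt_top_iff.1 hF i j).memLp le_rfl
  refine HasWeakPartial.of_tendsto (V := fun N x => S N x i j) (W := fun N x => DS N x i j)
    (fun N => (hS N i j).hasWeakPartial) (fun N => (hS N i j).memHs.memLp hs0)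
    (fun N => (hS N i j).memHs_zero_right.memLp le_rfl) (memLp ?_) (memLp ?_) (conv _ _ t1)
    (conv _ _ t2)
  · rw [eexp]
    exact (matNorm_add_le le_rfl).trans_lt (ENNReal.add_lt_top.2 ⟨matNorm_one_lt_top hb hm,
      (matNorm_dexpField_le le_rfl (hC Ω) hle h0).trans_lt
        (ENNReal.mul_lt_top (expBound_ne_top _).lt_top hX0)⟩)
  · exact (matNorm_dexpField_le le_rfl (hC Ω) hle hle).trans_lt
        (ENNReal.mul_lt_top (expBound_ne_top _).lt_top hDX)

/-! ### The pointwise identity -/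

lemma strain_transpose (L : Mat) : (strain L)ᵀ = strain L := by
  simp [strain, add_comm]

/-- The functional calculus term: `dexp_Ψ (P(e^Ψ) e^{-Ψ}) = P(e^Ψ)`. -/
lemma dexp_cfc {A : Mat} (hA : Aᵀ = A) (P : ℝ → ℝ) :
    dexp A A (cfc P (NormedSpace.exp A) * NormedSpace.exp (-A)) = cfc P (NormedSpace.exp A) := by
  have hsa : IsSelfAdjoint A := by
    rw [IsSelfAdjoint, Matrix.star_eq_conjTranspose, Matrix.conjTranspose_eq_transpose_of_trivial,
      hA]
  have hexp : IsSelfAdjoint (NormedSpace.exp A) := Matrix.IsHermitian.exp hsa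
  have c1 : Commute (NormedSpace.exp A) A := commute_exp (Commute.refl A)
  have c2 : Commute (cfc P (NormedSpace.exp A)) A := c1.cfc_real P
  have c3 : Commute (NormedSpace.exp (-A)) A := commute_exp (Commute.refl A).neg_left
  have h1 : NormedSpace.exp (-A) * NormedSpace.exp A = 1 := by
    rw [← Matrix.exp_add_of_commute _ _ (Commute.refl A).neg_left, neg_add_cancel,
      NormedSpace.exp_zero]
  rw [dexp_of_commute (c2.mul_left c3).symm, mul_assoc, h1, mul_one]

/-- The derivative of the exponential at `A` maps each term of the log-conformation equation to the
corresponding term of the constitutive equation. -/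
lemma constitutive_of_logConf {A A' L : Mat} (hA : Aᵀ = A) {D : Fin 2 → Mat} {u : Fin 2 → ℝ}
    {lam : ℝ} {P : ℝ → ℝ}
    (h : A' + ∑ k, u k • D k + (A * vorticity L - vorticity L * A)
          + (1 / lam) • (cfc P (NormedSpace.exp A) * NormedSpace.exp (-A))
          - (2 : ℝ) • strain L
          - (2 * (gam A * strain L 0 1 - A 0 1 * gam (strain L)) * f A) • rotMat A = 0) :
    dexp A A A' + ∑ k, u k • dexp A A (D k)
        - (strain L + vorticity L) * NormedSpace.exp A
        - NormedSpace.exp A * (strain L - vorticity L)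
      = -(1 / lam) • cfc P (NormedSpace.exp A) := by
  have h2 := congrArg (dexp A A) h
  rw [sub_sub, dexp_sub, dexp_strain hA (strain_transpose L), dexp_zero, dexp_add, dexp_add,
    dexp_add, dexp_sum, dexp_commutator, dexp_smul, dexp_cfc hA] at h2
  simp only [dexp_smul] at h2
  rw [neg_smul, eq_neg_iff_add_eq_zero, ← h2]
  noncomm_ring

end ChainRules

end LogConf

theorem theorem2 (Ω : Set LogConf.Plane) (hΩ : LogConf.IsBoundedLipschitzDomain Ω)
    (s : ℝ) (hs : 1 < s) (T : ℝ) (hT : 0 < T) (lam : ℝ) (hlam : 0 < lam)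
    (P : ℝ → ℝ) (hP : AnalyticOnNhd ℝ P (Set.Ioi 0))
    (u : ℝ → LogConf.Plane → LogConf.Plane)
    (hu : ∀ i, LogConf.MemC0Hs s T Ω (fun t x => u t x i))
    (Ψ : ℝ → LogConf.Plane → LogConf.Mat) (hΨ : LogConf.MemHsym s T Ω Ψ)
    (hsol : LogConf.SolvesLogConf s T Ω lam P u Ψ) :
    LogConf.MemHsym s T Ω (fun t x => NormedSpace.exp (Ψ t x)) ∧
      LogConf.SolvesConstitutive s T Ω lam P u (fun t x => NormedSpace.exp (Ψ t x)) := by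
  obtain ⟨Ψ', DΨ, L, h1, h2, h3, h4⟩ := hsol
  have hb := hΩ.isBounded
  have hm := hΩ.isOpen.measurableSet
  have hc : LogConf.MatC0 s T Ω Ψ := LogConf.matC0_iff.2 fun i j => (hΨ.1 i j).1
  have hexp := LogConf.matC0_iff.1 (hc.exp hb hm hs)
  have htime := LogConf.isTimeDerivative_exp hs hc h1
  refine ⟨⟨fun i j => ⟨hexp i j, _, htime i j⟩, fun t ht => ?_⟩, ?_⟩
  · filter_upwards [hΨ.2 t ht] with x hx
    rw [← Matrix.exp_transpose, hx]
  · refine ⟨_, fun k t => LogConf.dexpField (Ψ t) (Ψ t) (DΨ k t), L, htime, ?_, h3, ?_⟩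
    · intro t ht k i j
      have hpart : LogConf.MatPartial s Ω k (Ψ t) (DΨ k t) := fun i j =>
        (h2 t ht k i j).hasSobolevPartial hΩ.isOpen hs.le ((hΨ.1 i j).1.1 t ht)
      exact hpart.exp hb hm hs i j
    · intro t ht
      filter_upwards [h4 t ht, hΨ.2 t ht] with x hx hsym
      exact LogConf.constitutive_of_logConf hsym hx
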